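/- Let $G$ be a finite group, $p$ a prime, and $P\in\mathrm{Syl}_p(G)$. Assume that $G$ is $p$-solvable (it has a series $1=N_0\le N_1\le\cdots\le N_n=G$ of normal subgroups of $G$ whose factors have order a power of $p$ or coprime to $p$) and that $\mathbf N_G(P)=P$. All characters are complex; $\mathrm{Irr}_{p'}(X)$ is the set of irreducible characters of $X$ of degree not divisible by $p$; $P^g=g^{-1}Pg$; and $\mathrm{Irr}(P/P')$, where $P'$ is the derived subgroup of $P$, is identified by inflation with the set of linear characters of $P$. A subgroup $Q\le P$ is *picky* if, for every $g\in G$, $Q\le P^g$ implies $P^g=P$. (1) For every $\chi\in\mathrm{Irr}_{p'}(G)$ one can choose a linear character $\lambda_\chi\in\mathrm{Irr}(P)$ and a character (or zero) $\Delta_\chi$ of $P$ such that $$\chi_P=\lambda_\chi+\Delta_\chi,$$ where $\Delta_\chi$ is a (possibly empty) sum of characters induced to $P$ from characters of non-picky subgroups of $P$, and such that the map $\chi\mapsto\lambda_\chi$ is a bijection from $\mathrm{Irr}_{p'}(G)$ onto $\mathrm{Irr}(P/P')$. (2) In particular, Evseev's condition (IRC-Syl) holds for $G$: with $H=\mathbf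 N_G(P)$, there is a bijection $F:\pm\mathrm{Irr}_{p'}(G)\to\pm\mathrm{Irr}_{p'}(H)$ with $F(-\chi)=-F(\chi)$ and $$F(\chi)-\chi_H\in I(H,P,S(G,P,H))\qquad\text{for every }\chi\in\pm\mathrm{Irr}_{p'}(G).$$ Here $S(G,P,H)=\{Q\le P\mid Q\le P^t\text{ for some }t\in G\setminus H\}$, and for a finite group $X\ge P$ and a set $S$ of subgroups of $P$, $I(X,P,S)$ is the additive group generated by all induced generalized characters $\theta^X$, where $\theta\in\mathbb Z\,\mathrm{Irr}(L)$ for some subgroup $L\le X$ with $L\cap P\in\mathrm{Syl}_p(L)$ and $L\cap P\in S$. -/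

import Mathlib

namespace EvseevPicky

/-- `f : X → ℂ` is the character of a finite-dimensional complex representation of `X`.
The zero representation is allowed, so "character" here means "character or zero". -/
def IsCharacterOrZero {X : Type*} [Group X] (f : X → ℂ) : Prop :=
  ∃ (n : ℕ) (ρ : Representation ℂ X (Fin n → ℂ)), f = ρ.character

/-- `Irr(X)`: the set of irreducible complex characters of `X`, as functions `X → ℂ`. -/
def Irr (X : Type*) [Group X] : Set (X → ℂ) :=
  {χ | ∃ (n : ℕ) (ρ : Representation ℂ X (Fin n → ℂ)), ρ.IsIrreducible ∧ χ = ρ.character}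

/-- `Irr_{p'}(X)`: the irreducible complex characters of degree not divisible by `p`. -/
def IrrPrime (p : ℕ) (X : Type*) [Group X] : Set (X → ℂ) :=
  {χ | χ ∈ Irr X ∧ ∃ d : ℕ, χ 1 = (d : ℂ) ∧ ¬ p ∣ d}

/-- `± Irr_{p'}(X)`. -/
def SignedIrrPrime (p : ℕ) (X : Type*) [Group X] : Set (X → ℂ) :=
  {f | f ∈ IrrPrime p X ∨ -f ∈ IrrPrime p X}

/-- `𝒞(X) = ℤ Irr(X)`: the group of generalized (virtual) characters of `X`. -/
def genChar (X : Type*) [Group X] : AddSubgroup (X → ℂ) :=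
  AddSubgroup.closure (Irr X)

/-- Restriction of a function on `X` to a subgroup. -/
def res {X : Type*} [Group X] (L : Subgroup X) (f : X → ℂ) : L → ℂ :=
  fun x => f (x : X)

open Classical in
/-- The induced function `θ^X` (for `X` finite):
`θ^X(x) = |L|⁻¹ ∑_{y ∈ X} θ°(y⁻¹ x y)`, where `θ°` is `θ` extended by zero outside `L`. -/
noncomputable def ind {X : Type*} [Group X] (L : Subgroup X) (θ : L → ℂ) : X → ℂ :=
  fun x => (Nat.card L : ℂ)⁻¹ *
    ∑ᶠ y : X, if h : y⁻¹ * x * y ∈ L then θ ⟨y⁻¹ * x * y, h⟩ else 0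

/-- The conjugate subgroup `P^g = g⁻¹ P g`. -/
def conjBy {X : Type*} [Group X] (P : Subgroup X) (g : X) : Subgroup X :=
  P.map (MulAut.conj g⁻¹).toMonoidHom

/-- A finite group `X` is `p`-solvable: it has a series `1 = N 0 ≤ N 1 ≤ ⋯ ≤ N n = X` of normal
subgroups of `X`, each factor of which has order a power of `p` or coprime to `p`. -/
def IsPSolvable (p : ℕ) (X : Type*) [Group X] : Prop :=
  ∃ (n : ℕ) (N : ℕ → Subgroup X), N 0 = ⊥ ∧ N n = ⊤ ∧ (∀ i, (N i).Normal) ∧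
    ∀ i < n, N i ≤ N (i + 1) ∧
      ((∃ k : ℕ, (N i).relIndex (N (i + 1)) = p ^ k) ∨
        ((N i).relIndex (N (i + 1))).Coprime p)

/-- A subgroup `Q` of `P ≤ X` is picky (in `X`): `Q ≤ P^g` implies `P^g = P`, for all `g ∈ X`. -/
def IsPicky {X : Type*} [Group X] (P : Subgroup X) (Q : Subgroup P) : Prop :=
  ∀ g : X, Q.map P.subtype ≤ conjBy P g → conjBy P g = P

/-- The (finite, possibly empty) sums of characters of `P` induced from
characters of non-picky subgroups of `P`. -/
def sumsIndNonPicky {X : Type*} [Group X] (P : Subgroup X) : AddSubmonoid (P → ℂ) :=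
  AddSubmonoid.closure
    {f | ∃ (Q : Subgroup P) (θ : Q → ℂ), ¬ IsPicky P Q ∧ IsCharacterOrZero θ ∧ f = ind Q θ}

/-- `I(X, P, S)`: the additive group spanned by all `θ^X`, where `θ ∈ 𝒞(L)` for some subgroup
`L ≤ X` such that `L ∩ P ∈ Syl_p(L)` and `L ∩ P ∈ S`. -/
noncomputable def evI (p : ℕ) {X : Type*} [Group X] (P : Subgroup X) (S : Set (Subgroup X)) :
    AddSubgroup (X → ℂ) :=
  AddSubgroup.closure
    {f | ∃ (L : Subgroup X) (θ : L → ℂ), θ ∈ genChar L ∧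
      (∃ R : Sylow p L, (R : Subgroup L) = P.subgroupOf L) ∧ L ⊓ P ∈ S ∧ f = ind L θ}

/-- `S(G, P, H) = {Q ≤ P ∣ Q ≤ P^t for some t ∉ H}`. -/
def evS {G : Type*} [Group G] (P H : Subgroup G) : Set (Subgroup G) :=
  {Q | Q ≤ P ∧ ∃ t : G, t ∉ H ∧ Q ≤ conjBy P t}

/-- The condition (IRC-Syl) for `G`, `p` and `P ∈ Syl_p(G)`; with `H = N_G(P)`, there is a signed
bijection `F : ± Irr_{p'}(G) → ± Irr_{p'}(H)` with `F(χ) - χ_H ∈ I(H, P, S(G, P, H))`.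
Subgroups of `P` and of `H` are here regarded as subgroups of `G` or of `H` as appropriate. -/
def IRCSyl (p : ℕ) {G : Type*} [Group G] (P : Sylow p G) : Prop :=
  let H : Subgroup G := Subgroup.normalizer (P : Set G)
  ∃ F : (G → ℂ) → (H → ℂ),
    Set.BijOn F (SignedIrrPrime p G) (SignedIrrPrime p H) ∧
    ∀ χ ∈ SignedIrrPrime p G, F (-χ) = -F χ ∧
      F χ - res H χ ∈ evI p ((P : Subgroup G).subgroupOf H)
        {Q : Subgroup H | Q.map H.subtype ∈ evS (P : Subgroup G) H}

end EvseevPicky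

/-!
Let `ρ` be irreducible of degree prime to `p`. Its restriction to the `p`-group `P` has a linear
constituent `ν`. That `ν` is unique, that the rest of the restriction is a sum of characters
induced from non-picky subgroups, and that `ν` determines `ρ`, is proved by induction on `|G|`,
using Clifford theory over a normal subgroup `N ≠ 1` that is a `p`-group or has order prime to `p`.

* If `N` has order prime to `p`, the only element of `N` fixed by `P` is `1`, as `P` is
  self-normalizing. Hence the sum of the character of `ρ` over `N` is congruent to its degree
  modulo `p`, so `ρ` has nonzero `N`-invariants, and `N` acts trivially: pass to `G / N`.
* If `N` is a `p`-group, `N ≤ P` and `ν` restricts to a `P`-invariant `μ` of `N`. If `μ` is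
  `G`-invariant, then a power of `det ρ` extends it to `G`, and twisting by the inverse of this
  extension reduces to `G / N`. Otherwise pass to the stabilizer of `μ`, acting on the weight space
  of `μ`. The other weights in the `G`-orbit of `μ` contribute characters induced from their
  stabilizers in `P`, and these are non-picky: a subgroup `Q ≤ P` fixing `g • μ ≠ μ` satisfies
  `Q ≤ P ^ h` for some `h ∉ P`.

Every `ν` occurs, because the coinduced module of `ν` has degree `|G : P|`, so that one of its
irreducible constituents has degree prime to `p`.
-/

universe u v

namespace EvseevPicky

open Representation

section Irreducible

variable {k G V W : Type*} [Field k] [Group G] [AddCommGroup V] [Module k V]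
  [AddCommGroup W] [Module k W]

theorem isIrreducible_iff (ρ : Representation k G V) :
    ρ.IsIrreducible ↔ Nontrivial V ∧
      ∀ U : Submodule k V, (∀ g, ∀ v ∈ U, ρ g v ∈ U) → U = ⊥ ∨ U = ⊤ := by
  rw [irreducible_iff_isSimpleModule_asModule, isSimpleModule_iff,
    ← ρ.mapSubmodule.isSimpleOrder_iff, isSimpleOrder_iff, invtSubmodule.nontrivial_iff]
  simp only [Subtype.forall, mem_invtSubmodule, Module.End.mem_invtSubmodule, SetLike.le_def,
    Submodule.mem_comap, ← Subtype.coe_inj, invtSubmodule.coe_bot, invtSubmodule.coe_top]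

theorem isIrreducible_of_equiv {ρ : Representation k G V} {σ : Representation k G W}
    (φ : ρ.Equiv σ) (hρ : ρ.IsIrreducible) : σ.IsIrreducible := by
  rw [isIrreducible_iff] at hρ ⊢
  have := hρ.1
  have hφ (g : G) (v : V) : φ.toLinearEquiv (ρ g v) = σ g (φ.toLinearEquiv v) :=
    φ.toIntertwiningMap.isIntertwining _ _ g v
  refine ⟨φ.symm.toLinearEquiv.toEquiv.nontrivial, fun U hU => ?_⟩
  have hcomap := hρ.2 (U.comap φ.toLinearEquiv.toLinearMap) fun g v hv => by
    rw [Submodule.mem_comap, LinearEquiv.coe_coe, hφ]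
    exact hU g _ hv
  rw [← Submodule.map_comap_eq_of_surjective φ.toLinearEquiv.surjective U]
  exact hcomap.imp (fun h => by rw [h, Submodule.map_bot])
    fun h => by rw [h, Submodule.map_top, LinearMap.range_eq_top.2 φ.toLinearEquiv.surjective]

theorem isIrreducible_of_finrank_eq_one {ρ : Representation k G V}
    (h : Module.finrank k V = 1) : ρ.IsIrreducible := by
  have : IsSimpleModule k V := isSimpleModule_iff_finrank_eq_one.2 h
  exact (isIrreducible_iff ρ).2 ⟨IsSimpleModule.nontrivial k V, fun U _ => eq_bot_or_eq_top U⟩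

theorem exists_equiv_fin [FiniteDimensional k V] (ρ : Representation k G V) :
    ∃ σ : Representation k G (Fin (Module.finrank k V) → k), Nonempty (ρ.Equiv σ) := by
  let e := (Module.finBasis k V).equivFun
  refine ⟨(e.conjRingEquiv : _ →* _).comp ρ, ⟨.mk e fun g => ?_⟩⟩
  ext v
  simp

theorem exists_isCompl_subrepresentation [Finite G] [CharZero k] {ρ : Representation k G V}
    (U : Subrepresentation ρ) :
    ∃ U' : Subrepresentation ρ, IsCompl U.toSubmodule U'.toSubmodule := by
  have : NeZero (Nat.card G : k) := ⟨Nat.cast_ne_zero.2 Nat.card_pos.ne'⟩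
  obtain ⟨q, hq⟩ := MonoidAlgebra.Submodule.exists_isCompl (k := k) (G := G) U.asSubmodule
  have hdisj := Submodule.disjoint_def.1 hq.disjoint
  have hcodisj := Submodule.codisjoint_iff_exists_add_eq.1 hq.codisjoint
  refine ⟨Subrepresentation.ofSubmodule' q, ?_, ?_⟩
  · exact Submodule.disjoint_def.2 hdisj
  · exact Submodule.codisjoint_iff_exists_add_eq.2 hcodisj

theorem exists_isCompl_finrank_lt [Finite G] [CharZero k] [FiniteDimensional k V] [Nontrivial V]
    {ρ : Representation k G V} (hρ : ¬ ρ.IsIrreducible) :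
    ∃ U U' : Subrepresentation ρ, IsCompl U.toSubmodule U'.toSubmodule ∧
      Module.finrank k U.toSubmodule < Module.finrank k V ∧
      Module.finrank k U'.toSubmodule < Module.finrank k V := by
  obtain ⟨U, hU, hbot, htop⟩ : ∃ U : Submodule k V,
      (∀ g, ∀ v ∈ U, ρ g v ∈ U) ∧ U ≠ ⊥ ∧ U ≠ ⊤ := by
    simpa [isIrreducible_iff, ‹Nontrivial V›] using hρ
  obtain ⟨U', hc⟩ := exists_isCompl_subrepresentation ⟨U, hU⟩
  have hadd := Submodule.finrank_add_eq_of_isCompl hc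
  have hU_pos := Submodule.one_le_finrank_iff.2 hbot
  exact ⟨⟨U, hU⟩, U', hc, Submodule.finrank_lt htop, by lia⟩

theorem exists_isIrreducible_injective_of_not_dvd_finrank {V : Type u} [AddCommGroup V]
    [Module k V] [Finite G] [CharZero k] [FiniteDimensional k V] {p : ℕ}
    (ρ : Representation k G V) (hp : ¬ p ∣ Module.finrank k V) :
    ∃ (n : ℕ) (σ : Representation k G (Fin n → k)) (f : σ.IntertwiningMap ρ),
      σ.IsIrreducible ∧ Function.Injective f ∧ ¬ p ∣ n := by
  induction hn : Module.finrank k V using Nat.strong_induction_on generalizing V with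
  | h n ih =>
  have of_proper (U : Subrepresentation ρ) (hU : Module.finrank k U.toSubmodule < n)
      (hpU : ¬ p ∣ Module.finrank k U.toSubmodule) :
      ∃ (n : ℕ) (σ : Representation k G (Fin n → k)) (f : σ.IntertwiningMap ρ),
        σ.IsIrreducible ∧ Function.Injective f ∧ ¬ p ∣ n := by
    obtain ⟨n, σ, f, hσ, hf, hpn⟩ := ih _ hU U.toRepresentation hpU rfl
    exact ⟨n, σ, .comp ⟨U.toSubmodule.subtype, fun _ => rfl⟩ f, hσ,
      U.toSubmodule.subtype_injective.comp hf, hpn⟩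
  by_cases hρ : ρ.IsIrreducible
  · obtain ⟨σ, ⟨φ⟩⟩ := exists_equiv_fin ρ
    exact ⟨_, σ, φ.symm.toIntertwiningMap, isIrreducible_of_equiv φ hρ, φ.symm.injective, hp⟩
  have hV : Nontrivial V := Module.nontrivial_of_finrank_pos (R := k)
    (Nat.pos_of_ne_zero fun h => hp (h ▸ dvd_zero p))
  obtain ⟨U, U', hc, hU, hU'⟩ := exists_isCompl_finrank_lt hρ
  by_cases hpU : p ∣ Module.finrank k U.toSubmodule
  · refine of_proper U' (hn ▸ hU') fun hpU' => hp ?_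
    exact Submodule.finrank_add_eq_of_isCompl hc ▸ dvd_add hpU hpU'
  · exact of_proper U (hn ▸ hU) hpU

end Irreducible

section Characters

variable {G V : Type*} [Group G] [AddCommGroup V] [Module ℂ V] [FiniteDimensional ℂ V]

theorem isCharacterOrZero_character (ρ : Representation ℂ G V) :
    IsCharacterOrZero ρ.character := by
  obtain ⟨σ, ⟨φ⟩⟩ := exists_equiv_fin ρ
  exact ⟨_, σ, char_iso φ⟩

theorem character_mem_irr {ρ : Representation ℂ G V} (hρ : ρ.IsIrreducible) :
    ρ.character ∈ Irr G := by
  obtain ⟨σ, ⟨φ⟩⟩ := exists_equiv_fin ρ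
  exact ⟨_, σ, isIrreducible_of_equiv φ hρ, char_iso φ⟩

end Characters

section Twist

variable {k G V : Type*} [Field k] [Group G] [AddCommGroup V] [Module k V]

/-- The tensor product of a representation with a linear character. -/
def twist (ρ : Representation k G V) (ν : G →* kˣ) : Representation k G V where
  toFun g := (ν g : k) • ρ g
  map_one' := by simp
  map_mul' g h := by rw [map_mul, map_mul, Units.val_mul, smul_mul_smul_comm]

theorem twist_apply (ρ : Representation k G V) (ν : G →* kˣ) (g : G) (v : V) :
    twist ρ ν g v = (ν g : k) • ρ g v := rfl

theorem twist_one (ρ : Representation k G V) : twist ρ 1 = ρ := by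
  ext g v
  simp [twist_apply]

theorem twist_twist (ρ : Representation k G V) (κ ν : G →* kˣ) :
    twist (twist ρ κ) ν = twist ρ (κ * ν) := by
  ext g v
  simp [twist_apply, smul_smul, mul_comm]

theorem character_twist (ρ : Representation k G V) (ν : G →* kˣ) (g : G) :
    (twist ρ ν).character g = ν g * ρ.character g :=
  map_smul (LinearMap.trace k V) (ν g : k) (ρ g)

theorem isIrreducible_twist {ρ : Representation k G V} (hρ : ρ.IsIrreducible) (ν : G →* kˣ) :
    (twist ρ ν).IsIrreducible := by
  rw [isIrreducible_iff] at hρ ⊢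
  refine ⟨hρ.1, fun U hU => hρ.2 U fun g v hv => ?_⟩
  exact (U.smul_mem_iff (ν g).ne_zero).1 (hU g v hv)

end Twist

section WeightSpace

variable {k G V : Type*} [Field k] [Group G] [AddCommGroup V] [Module k V]

/-- The vectors on which `G` acts through the linear character `ν`. Hence
`weightSpace ρ ν ≠ ⊥` says that `ν` is a constituent of `ρ`. -/
def weightSpace (ρ : Representation k G V) (ν : G →* kˣ) : Submodule k V where
  carrier := {v | ∀ g, ρ g v = (ν g : k) • v}
  add_mem' {v w} hv hw g := by rw [map_add, hv g, hw g, smul_add]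
  zero_mem' g := by simp
  smul_mem' c v hv g := by rw [map_smul, hv g, smul_comm]

variable {ρ : Representation k G V} {ν : G →* kˣ}

theorem mem_weightSpace {v : V} : v ∈ weightSpace ρ ν ↔ ∀ g, ρ g v = (ν g : k) • v := Iff.rfl

theorem weightSpace_twist (ρ : Representation k G V) (κ ν : G →* kˣ) :
    weightSpace (twist ρ κ) (κ * ν) = weightSpace ρ ν := by
  ext v
  refine forall_congr' fun g => ?_
  rw [twist_apply, MonoidHom.mul_apply, Units.val_mul, mul_smul,
    (smul_right_injective V (κ g).ne_zero).eq_iff]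

theorem eq_of_mem_weightSpace {ν' : G →* kˣ} {v : V} (hv : v ≠ 0) (h : v ∈ weightSpace ρ ν)
    (h' : v ∈ weightSpace ρ ν') : ν = ν' := by
  ext g
  exact smul_left_injective k hv ((h g).symm.trans (h' g))

theorem exists_mem_weightSpace {v : V} (hv : v ≠ 0) (h : ∀ g, ∃ c : k, ρ g v = c • v) :
    ∃ ν, v ∈ weightSpace ρ ν := by
  choose c hc using h
  let f : G →* k :=
    { toFun := c
      map_one' := smul_left_injective k hv (by simp [← hc])
      map_mul' := fun x y => smul_left_injective k hv (by
        simp only [mul_smul, ← hc, map_mul, Module.End.mul_apply]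
        rw [hc y, map_smul, hc x, smul_comm]) }
  exact ⟨f.toHomUnits, hc⟩

theorem exists_weightSpace_eq_top_of_finrank_eq_one (ρ : Representation k G V)
    (h : Module.finrank k V = 1) : ∃ ν, weightSpace ρ ν = ⊤ := by
  obtain ⟨v, hv, hspan⟩ := finrank_eq_one_iff'.1 h
  obtain ⟨ν, hν⟩ := exists_mem_weightSpace (ρ := ρ) hv fun g => by
    obtain ⟨c, hc⟩ := hspan (ρ g v)
    exact ⟨c, hc.symm⟩
  refine ⟨ν, Submodule.eq_top_iff'.2 fun w => ?_⟩
  obtain ⟨c, rfl⟩ := hspan w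
  exact Submodule.smul_mem _ c hν

theorem character_eq_of_weightSpace_eq_top [FiniteDimensional k V]
    (h : weightSpace ρ ν = ⊤) (g : G) :
    ρ.character g = ν g * Module.finrank k V := by
  have hg : ρ g = (ν g : k) • LinearMap.id := by
    ext v
    exact Submodule.eq_top_iff'.1 h v g
  rw [Representation.character, hg, map_smul, LinearMap.trace_id, smul_eq_mul]

theorem linear_mem_irr (ν : G →* ℂˣ) : (fun g => (ν g : ℂ)) ∈ Irr G := by
  have h : (fun g => (ν g : ℂ)) = (twist (trivial ℂ G ℂ) ν).character := by
    ext g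
    rw [character_twist]
    simp [Representation.character]
  rw [h]
  exact character_mem_irr (isIrreducible_of_finrank_eq_one (Module.finrank_self ℂ))

end WeightSpace

section WeightProjection

variable {k G V : Type*} [Field k] [Group G] [AddCommGroup V] [Module k V]

/-- The projection onto `weightSpace ρ ν` along the other weight spaces, for a finite group `G`
whose order is invertible in `k`. -/
noncomputable def weightProj (ρ : Representation k G V) (ν : G →* kˣ) : Module.End k V :=
  (Nat.card G : k)⁻¹ • ∑ᶠ g, ((ν g⁻¹ : kˣ) : k) • ρ g

theorem weightProj_apply [Fintype G] (ρ : Representation k G V) (ν : G →* kˣ) (v : V) :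
    weightProj ρ ν v = (Nat.card G : k)⁻¹ • ∑ g, ((ν g⁻¹ : kˣ) : k) • ρ g v := by
  simp [weightProj, finsum_eq_sum_of_fintype, LinearMap.sum_apply]

variable [Finite G] {ρ : Representation k G V} {ν : G →* kˣ} {v : V}

theorem weightProj_mem (ρ : Representation k G V) (ν : G →* kˣ) (v : V) :
    weightProj ρ ν v ∈ weightSpace ρ ν := by
  have := Fintype.ofFinite G
  intro h
  rw [weightProj_apply, map_smul, smul_comm (ν h : k), map_sum, Finset.smul_sum (r := (ν h : k))]
  congr 1
  refine Fintype.sum_equiv (Equiv.mulLeft h) _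
    (fun g => (ν h : k) • ((ν g⁻¹ : kˣ) : k) • ρ g v) fun g => ?_
  rw [map_smul, ← Module.End.mul_apply, ← map_mul, smul_smul, ← Units.val_mul, ← map_mul]
  simp

theorem weightProj_of_mem_of_ne {ν' : G →* kˣ} (h : ν ≠ ν') (hv : v ∈ weightSpace ρ ν') :
    weightProj ρ ν v = 0 := by
  have := Fintype.ofFinite G
  have hmem : weightProj ρ ν v ∈ weightSpace ρ ν' := by
    rw [weightProj_apply]
    refine Submodule.smul_mem _ _ (sum_mem fun g _ => Submodule.smul_mem _ _ ?_)
    rw [hv g]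
    exact Submodule.smul_mem _ _ hv
  by_contra h0
  exact h (eq_of_mem_weightSpace h0 (weightProj_mem ρ ν v) hmem)

variable [CharZero k]

theorem weightProj_of_mem (hv : v ∈ weightSpace ρ ν) : weightProj ρ ν v = v := by
  have := Fintype.ofFinite G
  rw [weightProj_apply]
  simp_rw [hv _, smul_smul, ← Units.val_mul, ← map_mul]
  simp [← Nat.cast_smul_eq_nsmul k, smul_smul]

theorem isProj_weightProj (ρ : Representation k G V) (ν : G →* kˣ) :
    LinearMap.IsProj (weightSpace ρ ν) (weightProj ρ ν) :=
  ⟨weightProj_mem ρ ν, fun _ => weightProj_of_mem⟩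

end WeightProjection

section NormalSubgroup

variable {k G V : Type*} [Field k] [Group G] [AddCommGroup V] [Module k V] {N : Subgroup G}

/-- The restriction of a representation to a subgroup. -/
abbrev resRep (ρ : Representation k G V) (H : Subgroup G) : Representation k H V :=
  MonoidHom.comp ρ H.subtype

variable [N.Normal]

/-- The conjugation action of a group on the linear characters of a normal subgroup. -/
instance conjAction : MulAction G (N →* kˣ) where
  smul g μ := μ.comp (MulAut.conjNormal g⁻¹ : N ≃* N).toMonoidHom
  one_smul μ := by
    ext n
    change ((μ (MulAut.conjNormal (1 : G)⁻¹ n) : kˣ) : k) = μ n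
    simp
  mul_smul g h μ := by
    ext n
    change ((μ (MulAut.conjNormal (g * h)⁻¹ n) : kˣ) : k) =
      μ (MulAut.conjNormal h⁻¹ (MulAut.conjNormal g⁻¹ n))
    rw [mul_inv_rev, map_mul, MulAut.mul_apply]

theorem conj_smul_apply (g : G) (μ : N →* kˣ) (n : N) :
    (g • μ) n = μ (MulAut.conjNormal g⁻¹ n) := rfl

variable {ρ : Representation k G V} {μ : N →* kˣ}

theorem map_mem_weightSpace {v : V} (hv : v ∈ weightSpace (resRep ρ N) μ) (g : G) :
    ρ g v ∈ weightSpace (resRep ρ N) (g • μ) := by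
  intro n
  have hconj : (n : G) * g = g * (MulAut.conjNormal g⁻¹ n : N) := by
    rw [MulAut.conjNormal_apply]
    group
  have hn : ρ (MulAut.conjNormal g⁻¹ n : N) v = (μ (MulAut.conjNormal g⁻¹ n) : k) • v :=
    hv (MulAut.conjNormal g⁻¹ n)
  change ρ n (ρ g v) = _
  rw [← Module.End.mul_apply, ← map_mul, hconj, map_mul, Module.End.mul_apply, hn, map_smul,
    conj_smul_apply]

/-- The action of the stabilizer of `μ` on the weight space of `μ`. -/
def stabRep (ρ : Representation k G V) (μ : N →* kˣ) :
    Representation k (MulAction.stabilizer G μ) (weightSpace (resRep ρ N) μ) :=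
  Subrepresentation.toRepresentation (ρ := resRep ρ (MulAction.stabilizer G μ))
    ⟨weightSpace (resRep ρ N) μ, fun g v hv => by
      have h := map_mem_weightSpace hv (g : G)
      rwa [g.2] at h⟩

theorem coe_stabRep_apply (g : MulAction.stabilizer G μ) (v : weightSpace (resRep ρ N) μ) :
    (stabRep ρ μ g v : V) = ρ g v := rfl

variable [Finite N]

theorem map_weightProj (ρ : Representation k G V) (μ : N →* kˣ) (g : G) (v : V) :
    ρ g (weightProj (resRep ρ N) μ v) = weightProj (resRep ρ N) (g • μ) (ρ g v) := by
  have := Fintype.ofFinite N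
  rw [weightProj_apply, weightProj_apply, map_smul, map_sum]
  congr 1
  refine Fintype.sum_equiv (MulAut.conjNormal g : N ≃* N).toEquiv _ _ fun n => ?_
  simp [conj_smul_apply, ← Module.End.mul_apply, ← map_mul]

theorem weightProj_map_eq_zero [CharZero k] {g : G} (h : g • μ ≠ μ) {v : V}
    (hv : v ∈ weightSpace (resRep ρ N) μ) : weightProj (resRep ρ N) μ (ρ g v) = 0 :=
  weightProj_of_mem_of_ne h.symm (map_mem_weightSpace hv g)

end NormalSubgroup

section WeightCharacter

variable {k G V : Type*} [Field k] [Group G] [AddCommGroup V] [Module k V] {N : Subgroup G}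

/-- The trace of `x` followed by the compression to the weight space of `μ`. For `x` stabilizing
`μ` this is the trace of `x` on that weight space. -/
noncomputable def weightCharacter (ρ : Representation k G V) (μ : N →* kˣ) (x : G) : k :=
  LinearMap.trace k V (ρ x * weightProj (resRep ρ N) μ)

variable [Finite N]

theorem weightCharacter_one [CharZero k] [FiniteDimensional k V] (ρ : Representation k G V)
    (μ : N →* kˣ) :
    weightCharacter ρ μ 1 = Module.finrank k (weightSpace (resRep ρ N) μ) := by
  rw [weightCharacter, map_one, one_mul, (isProj_weightProj _ μ).trace]

variable [N.Normal]

theorem weightCharacter_conj (ρ : Representation k G V) (μ : N →* kˣ) (g x : G) :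
    weightCharacter ρ (g • μ) (g * x * g⁻¹) = weightCharacter ρ μ x := by
  have hconj : ρ (g * x * g⁻¹) * weightProj (resRep ρ N) (g • μ) =
      ρ g * (ρ x * weightProj (resRep ρ N) μ * ρ g⁻¹) := by
    ext v
    simp only [map_mul, Module.End.mul_apply]
    rw [map_weightProj ρ (g • μ), inv_smul_smul]
  rw [weightCharacter, hconj, LinearMap.trace_mul_comm, mul_assoc, ← map_mul]
  simp [weightCharacter]

variable [CharZero k]

theorem weightCharacter_eq_zero (ρ : Representation k G V) {μ : N →* kˣ} {x : G}
    (h : x • μ ≠ μ) : weightCharacter ρ μ x = 0 := by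
  set e := weightProj (resRep ρ N) μ with he
  have hmul : e * (ρ x * e) = 0 := by
    ext v
    exact weightProj_map_eq_zero h (weightProj_mem _ μ v)
  have hidem : e * e = e := (isProj_weightProj _ μ).isIdempotentElem
  rw [weightCharacter, ← he, ← hidem, ← mul_assoc, LinearMap.trace_mul_comm, hmul, map_zero]

theorem finrank_weightSpace_smul [FiniteDimensional k V]
    (ρ : Representation k G V) (μ : N →* kˣ) (g : G) :
    Module.finrank k (weightSpace (resRep ρ N) (g • μ)) =
      Module.finrank k (weightSpace (resRep ρ N) μ) := by
  have h := weightCharacter_conj ρ μ g 1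
  rw [mul_one, mul_inv_cancel, weightCharacter_one, weightCharacter_one] at h
  exact_mod_cast h

end WeightCharacter

section Clifford

variable {k G V : Type*} [Field k] [Group G] [AddCommGroup V] [Module k V] {N : Subgroup G}
  [N.Normal] [Finite N] [CharZero k] {ρ : Representation k G V} {μ : N →* kˣ}

theorem sum_orbit_weightProj [Fintype (MulAction.orbit G μ)] (hρ : ρ.IsIrreducible)
    (hμ : weightSpace (resRep ρ N) μ ≠ ⊥) :
    ∑ b : MulAction.orbit G μ, weightProj (resRep ρ N) (b : N →* kˣ) = 1 := by
  set E := ∑ b : MulAction.orbit G μ, weightProj (resRep ρ N) (b : N →* kˣ) with hE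
  have map_E (g : G) (v : V) : ρ g (E v) = E (ρ g v) := by
    rw [hE, LinearMap.sum_apply, LinearMap.sum_apply, map_sum]
    exact Fintype.sum_equiv (MulAction.toPerm g : Equiv.Perm (MulAction.orbit G μ)) _ _
      fun b => map_weightProj ρ (b : N →* kˣ) g v
  have E_of_mem {v : V} (hv : v ∈ weightSpace (resRep ρ N) μ) : E v = v := by
    rw [hE, LinearMap.sum_apply, Fintype.sum_eq_single ⟨μ, MulAction.mem_orbit_self μ⟩]
    · exact weightProj_of_mem hv
    · exact fun b hb => weightProj_of_mem_of_ne (fun h => hb (Subtype.ext h)) hv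
  have hker := (((isIrreducible_iff ρ).1 hρ).2 (LinearMap.ker (E - 1)) fun g v hv => by
    rw [LinearMap.mem_ker, LinearMap.sub_apply, Module.End.one_apply, sub_eq_zero] at hv ⊢
    rw [← map_E, hv]).resolve_left fun hbot => hμ <| by
      rw [eq_bot_iff, ← hbot]
      intro v hv
      simp [E_of_mem hv]
  rwa [LinearMap.ker_eq_top, sub_eq_zero] at hker

theorem mem_orbit_of_weightSpace_ne_bot [Finite (MulAction.orbit G μ)] {μ' : N →* kˣ}
    (hρ : ρ.IsIrreducible) (hμ : weightSpace (resRep ρ N) μ ≠ ⊥)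
    (hμ' : weightSpace (resRep ρ N) μ' ≠ ⊥) : μ' ∈ MulAction.orbit G μ := by
  have := Fintype.ofFinite (MulAction.orbit G μ)
  obtain ⟨v, hv, hv0⟩ := Submodule.exists_mem_ne_zero_of_ne_bot hμ'
  by_contra hμμ'
  apply hv0
  rw [← Module.End.one_apply (R := k) v, ← sum_orbit_weightProj hρ hμ, LinearMap.sum_apply]
  exact Finset.sum_eq_zero fun b _ =>
    weightProj_of_mem_of_ne (fun h : (b : N →* kˣ) = μ' => hμμ' (h ▸ b.2)) hv

theorem character_eq_sum_weightCharacter [Fintype (MulAction.orbit G μ)]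
    (hρ : ρ.IsIrreducible) (hμ : weightSpace (resRep ρ N) μ ≠ ⊥) (x : G) :
    ρ.character x = ∑ b : MulAction.orbit G μ, weightCharacter ρ (b : N →* kˣ) x := by
  simp_rw [weightCharacter]
  rw [← map_sum, ← Finset.mul_sum, sum_orbit_weightProj hρ hμ, mul_one, Representation.character]

theorem finrank_eq_card_orbit_mul [Finite (MulAction.orbit G μ)] [FiniteDimensional k V]
    (hρ : ρ.IsIrreducible) (hμ : weightSpace (resRep ρ N) μ ≠ ⊥) :
    Module.finrank k V =
      Nat.card (MulAction.orbit G μ) * Module.finrank k (weightSpace (resRep ρ N) μ) := by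
  have := Fintype.ofFinite (MulAction.orbit G μ)
  have h : (Module.finrank k V : k) = ∑ b : MulAction.orbit G μ,
      (Module.finrank k (weightSpace (resRep ρ N) (b : N →* kˣ)) : k) := by
    simp_rw [← weightCharacter_one, ← character_eq_sum_weightCharacter hρ hμ, char_one]
  norm_cast at h
  rw [h, Nat.card_eq_fintype_card, ← smul_eq_mul, ← Finset.card_univ, ← Finset.sum_const]
  refine Finset.sum_congr rfl fun b _ => ?_
  obtain ⟨g, hg⟩ := b.2
  rw [← finrank_weightSpace_smul ρ μ g, ← hg]

theorem character_stabRep [FiniteDimensional k V] (g : MulAction.stabilizer G μ) :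
    (stabRep ρ μ).character g = weightCharacter ρ μ g := by
  have hmem (v : V) :
      (ρ g * weightProj (resRep ρ N) μ) v ∈ weightSpace (resRep ρ N) μ := by
    have h := map_mem_weightSpace (weightProj_mem (resRep ρ N) μ v) (g : G)
    rwa [g.2] at h
  rw [weightCharacter, ← LinearMap.trace_restrict_eq_of_forall_mem _ _ hmem,
    Representation.character]
  congr 1
  ext v
  simp [weightProj_of_mem v.2, coe_stabRep_apply]

theorem isIrreducible_stabRep (hρ : ρ.IsIrreducible) (hμ : weightSpace (resRep ρ N) μ ≠ ⊥) :
    (stabRep ρ μ).IsIrreducible := by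
  set e := weightProj (resRep ρ N) μ
  refine (isIrreducible_iff _).2 ⟨Submodule.nontrivial_iff_ne_bot.2 hμ, fun U hU => ?_⟩
  let U' : Submodule k V := U.map (weightSpace (resRep ρ N) μ).subtype
  let W : Submodule k V := ⨅ g : G, U'.comap (e * ρ g)
  have mem_W (v : V) : v ∈ W ↔ ∀ g, e (ρ g v) ∈ U' := by simp [W, Submodule.mem_iInf]
  have hU'W : U' ≤ W := by
    rintro _ ⟨u, hu, rfl⟩
    refine (mem_W _).2 fun g => ?_
    by_cases hg : g • μ = μ
    · refine ⟨_, hU ⟨g, hg⟩ u hu, (weightProj_of_mem ?_).symm⟩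
      have h := map_mem_weightSpace u.2 g
      rwa [hg] at h
    · rw [Submodule.subtype_apply, weightProj_map_eq_zero hg u.2]
      exact zero_mem _
  have hW := ((isIrreducible_iff ρ).1 hρ).2 W fun g v hv => by
    rw [mem_W] at hv ⊢
    intro h
    rw [← Module.End.mul_apply (ρ h), ← map_mul]
    exact hv _
  refine hW.imp (fun hW => ?_) fun hW => Submodule.eq_top_iff'.2 fun v => ?_
  · rw [hW, le_bot_iff] at hU'W
    exact Submodule.map_injective_of_injective (Submodule.subtype_injective _)
      (hU'W.trans (Submodule.map_bot _).symm)
  · have hv : e (ρ 1 v) ∈ U' := (mem_W v).1 (hW ▸ Submodule.mem_top) 1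
    rw [map_one, Module.End.one_apply, weightProj_of_mem v.2] at hv
    obtain ⟨u, hu, huv⟩ := hv
    rwa [← Subtype.ext huv]

end Clifford

section OrbitSums

variable {P Y : Type*} [Group P] [MulAction P Y]

theorem sum_mem_of_sum_orbit_mem {M : Type*} [AddCommMonoid M] (S : AddSubmonoid M) (f : Y → M)
    (s : Finset Y) (hs : ∀ (g : P), ∀ y ∈ s, g • y ∈ s)
    (h : ∀ y ∈ s, ∀ t : Finset Y, (t : Set Y) = MulAction.orbit P y → ∑ z ∈ t, f z ∈ S) :
    ∑ y ∈ s, f y ∈ S := by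
  classical
  induction s using Finset.strongInduction with
  | H s ih =>
  rcases s.eq_empty_or_nonempty with rfl | ⟨y, hy⟩
  · simp
  let t := s.filter (· ∈ MulAction.orbit P y)
  have ht : (t : Set Y) = MulAction.orbit P y := by
    ext z
    simp only [t, Finset.coe_filter, Set.mem_ofPred_eq, and_iff_right_iff_imp]
    rintro ⟨g, rfl⟩
    exact hs g y hy
  have hts : t ⊆ s := s.filter_subset _
  have hyt : y ∈ t := by simp [t, hy]
  rw [← Finset.sum_sdiff hts]
  refine S.add_mem (ih _ (Finset.sdiff_ssubset hts ⟨y, hyt⟩) (fun g z hz => ?_)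
    fun z hz => h z (Finset.mem_sdiff.1 hz).1) (h y hy t ht)
  simp only [t, Finset.mem_sdiff, Finset.mem_filter, not_and] at hz ⊢
  refine ⟨hs g z hz.1, fun _ hgz => hz.2 hz.1 ?_⟩
  rwa [← MulAction.orbit_eq_iff, MulAction.orbit_smul, MulAction.orbit_eq_iff] at hgz

theorem sum_smul_eq_card_stabilizer_nsmul [Fintype P] {M : Type*} [AddCommMonoid M] (f : Y → M)
    {y : Y} {t : Finset Y} (ht : (t : Set Y) = MulAction.orbit P y) :
    ∑ g : P, f (g • y) = Nat.card (MulAction.stabilizer P y) • ∑ z ∈ t, f z := by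
  classical
  have hmem (g : P) : g • y ∈ t := by
    rw [← Finset.mem_coe, ht]
    exact MulAction.mem_orbit y g
  rw [← Finset.sum_fiberwise_of_maps_to (fun g _ => hmem g), Finset.smul_sum]
  refine Finset.sum_congr rfl fun z hz => ?_
  rw [← Finset.mem_coe, ht] at hz
  obtain ⟨h, rfl⟩ := hz
  have hcard : (Finset.univ.filter fun g : P => g • y = h • y).card =
      Nat.card (MulAction.stabilizer P y) := by
    rw [← Fintype.card_coe, ← Nat.card_eq_fintype_card]
    exact Nat.card_congr <| (Equiv.mulLeft h⁻¹).subtypeEquiv fun g => by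
      simp [mul_smul, inv_smul_eq_iff]
  rw [← hcard, ← Finset.sum_const]
  exact Finset.sum_congr rfl fun g hg => by rw [(Finset.mem_filter.1 hg).2]

theorem dvd_sum_of_eq_zero_of_fixed {p : ℕ} [Fact p.Prime] [Finite P] [Fintype Y]
    (hP : IsPGroup p P) {R : Type*} [CommRing R] (f : Y → R) (hf : ∀ (g : P) y, f (g • y) = f y)
    (h0 : ∀ y ∈ MulAction.fixedPoints P Y, f y = 0) : (p : R) ∣ ∑ y, f y := by
  rw [← Ideal.mem_span_singleton]
  refine sum_mem_of_sum_orbit_mem (P := P) (Ideal.span {(p : R)}).toAddSubmonoid f _ (by simp)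
    fun y _ t ht => ?_
  have hconst : ∀ z ∈ t, f z = f y := fun z hz => by
    rw [← Finset.mem_coe, ht] at hz
    obtain ⟨g, rfl⟩ := hz
    exact hf g y
  have hcard : t.card = Nat.card (MulAction.orbit P y) := by
    rw [← ht]
    simp
  obtain ⟨n, hn⟩ := hP.card_orbit y
  rw [Finset.sum_congr rfl hconst, Finset.sum_const, hcard, hn, nsmul_eq_mul]
  apply Ideal.mem_span_singleton.2
  rcases n with _ | n
  · have hy : y ∈ MulAction.fixedPoints P Y := by
      have := Fintype.ofFinite (MulAction.orbit P y)
      rw [MulAction.mem_fixedPoints_iff_card_orbit_eq_one, ← Nat.card_eq_fintype_card, hn, pow_zero]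
    rw [h0 y hy, mul_zero]
    exact dvd_zero _
  · exact Dvd.dvd.mul_right (Nat.cast_dvd_cast (dvd_pow_self p n.succ_ne_zero)) _

theorem dvd_sum_sub_of_fixedPoints_eq_singleton {p : ℕ} [Fact p.Prime] [Finite P] [Fintype Y]
    (hP : IsPGroup p P) {y₀ : Y} (hY : MulAction.fixedPoints P Y = {y₀}) {R : Type*} [CommRing R]
    (f : Y → R) (hf : ∀ (g : P) y, f (g • y) = f y) : (p : R) ∣ ∑ y, f y - f y₀ := by
  classical
  have hy₀ (g : P) : g • y₀ = y₀ := (hY ▸ Set.mem_singleton y₀ : y₀ ∈ MulAction.fixedPoints P Y) g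
  let f' : Y → R := f - Pi.single y₀ (f y₀)
  have hsum : ∑ y, f' y = ∑ y, f y - f y₀ := by simp [f']
  rw [← hsum]
  refine dvd_sum_of_eq_zero_of_fixed hP _ (fun g y => ?_) fun y hy => ?_
  · have hiff : g • y = y₀ ↔ y = y₀ := by rw [smul_eq_iff_eq_inv_smul, hy₀]
    simp only [f', Pi.sub_apply, Pi.single_apply, hf, hiff]
  · obtain rfl : y = y₀ := by rwa [hY] at hy
    simp [f']

theorem exists_extend_zero (L : Subgroup P) {A : Type*} [Zero A] (θ : L → A) :
    ∃ F : P → A, (∀ x ∉ L, F x = 0) ∧ θ = fun l : L => F l :=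
  ⟨Function.extend Subtype.val θ 0, fun x hx => Function.extend_apply' _ _ _ (by simpa using hx),
    funext fun l => (Subtype.val_injective.extend_apply θ 0 l).symm⟩

theorem ind_apply [Fintype P] {L : Subgroup P} {θ : P → ℂ} (hθ : ∀ x ∉ L, θ x = 0) (x : P) :
    ind L (fun l => θ l) x = (Nat.card L : ℂ)⁻¹ * ∑ y : P, θ (y⁻¹ * x * y) := by
  rw [ind, finsum_eq_sum_of_fintype]
  congr 1
  refine Finset.sum_congr rfl fun y _ => ?_
  split_ifs with h
  · rfl
  · exact (hθ _ h).symm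

variable [Finite P] {c : P → Y → ℂ}

theorem ind_stabilizer_apply (hc0 : ∀ x y, x • y ≠ y → c x y = 0)
    (hc : ∀ g x y, c (g * x * g⁻¹) (g • y) = c x y) {y : Y} {t : Finset Y}
    (ht : (t : Set Y) = MulAction.orbit P y) (x : P) :
    ind (MulAction.stabilizer P y) (fun q => c q y) x = ∑ z ∈ t, c x z := by
  have := Fintype.ofFinite P
  have hconj (g : P) : c (g⁻¹ * x * g) y = c x (g • y) := by
    rw [← hc g]
    congr 1
    group
  rw [ind_apply (θ := fun x => c x y) fun x hx => hc0 x y hx]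
  simp_rw [hconj]
  rw [sum_smul_eq_card_stabilizer_nsmul (fun z => c x z) ht, nsmul_eq_mul,
    inv_mul_cancel_left₀ (Nat.cast_ne_zero.2 Nat.card_pos.ne')]

theorem sum_mem_of_ind_stabilizer_mem (hc0 : ∀ x y, x • y ≠ y → c x y = 0)
    (hc : ∀ g x y, c (g * x * g⁻¹) (g • y) = c x y) (S : AddSubmonoid (P → ℂ)) {s : Finset Y}
    (hs : ∀ (g : P), ∀ y ∈ s, g • y ∈ s)
    (hS : ∀ y ∈ s, ind (MulAction.stabilizer P y) (fun q => c q y) ∈ S) :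
    (fun x => ∑ y ∈ s, c x y) ∈ S := by
  rw [← Finset.sum_fn]
  refine sum_mem_of_sum_orbit_mem (P := P) S (fun y x => c x y) s hs fun y hy t ht => ?_
  rw [Finset.sum_fn]
  convert hS y hy using 1
  exact funext fun x => (ind_stabilizer_apply hc0 hc ht x).symm

end OrbitSums

section Descent

variable {k G H V : Type*} [Field k] [Group G] [Group H] [AddCommGroup V] [Module k V]
  {N : Subgroup G}

theorem isIrreducible_of_comp {ρ : Representation k H V} {f : G →* H}
    (h : IsIrreducible (MonoidHom.comp ρ f)) : ρ.IsIrreducible := by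
  rw [isIrreducible_iff] at h ⊢
  exact ⟨h.1, fun U hU => h.2 U fun g => hU (f g)⟩

/-- Extending `μ` works because a power of `det ρ` restricts to `μ`: as `μ` has order a power of
`p`, some power `d ^ m` of the degree `d` satisfies `μ ^ d ^ m = μ`. -/
theorem exists_extension_of_weightSpace_eq_top [FiniteDimensional k V] {p : ℕ} [Fact p.Prime]
    [Finite N] (hN : IsPGroup p N) {ρ : Representation k G V} (hV : ¬ p ∣ Module.finrank k V)
    {μ : N →* kˣ} (hμ : weightSpace (resRep ρ N) μ = ⊤) :
    ∃ κ : G →* kˣ, κ.comp N.subtype = μ := by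
  have hp : p.Prime := Fact.out
  obtain ⟨m, hm⟩ := IsPGroup.iff_card.1 hN
  set d := Module.finrank k V
  have hcop : d.Coprime (p ^ m) := (hp.coprime_iff_not_dvd.2 hV).symm.pow_right m
  let δ : G →* kˣ := MonoidHom.toHomUnits ((LinearMap.det : Module.End k V →* k).comp ρ)
  have hδ (n : N) : δ n = μ n ^ d := by
    have hn : ρ n = (μ n : k) • (1 : Module.End k V) := by
      ext v
      exact Submodule.eq_top_iff'.1 hμ v n
    ext
    change LinearMap.det (ρ n) = _
    rw [hn, LinearMap.det_smul, map_one, mul_one, Units.val_pow_eq_pow_val]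
  refine ⟨δ ^ (d ^ (Nat.totient (p ^ m) - 1)), MonoidHom.ext fun n => ?_⟩
  have horder : orderOf (μ n) ∣ p ^ m := by
    rw [orderOf_dvd_iff_pow_eq_one, ← map_pow, ← hm, pow_card_eq_one', map_one]
  have hpow := pow_eq_pow_iff_modEq.2 ((Nat.ModEq.pow_totient hcop).of_dvd horder)
  rw [pow_one] at hpow
  rw [MonoidHom.comp_apply, Subgroup.coe_subtype, MonoidHom.pow_apply, hδ, ← pow_mul,
    ← pow_succ', Nat.sub_add_cancel (Nat.totient_pos.2 (pow_pos hp.pos m)), hpow]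

theorem card_quotient_lt [Finite G] (hN : N ≠ ⊥) : Nat.card (G ⧸ N) < Nat.card G := by
  rw [N.card_eq_card_quotient_mul_card_subgroup]
  exact lt_mul_of_one_lt_right Nat.card_pos (N.one_lt_card_iff_ne_bot.2 hN)

variable [N.Normal]

theorem exists_isIrreducible_comp_mk' {ρ : Representation k G V} (hρ : ρ.IsIrreducible)
    (h : weightSpace (resRep ρ N) 1 = ⊤) :
    ∃ σ : Representation k (G ⧸ N) V,
      σ.IsIrreducible ∧ ρ = MonoidHom.comp σ (QuotientGroup.mk' N) := by
  have hN : ∀ n ∈ N, ρ n = 1 := fun n hn => by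
    ext v
    simpa using Submodule.eq_top_iff'.1 h v ⟨n, hn⟩
  exact ⟨QuotientGroup.lift N ρ hN, isIrreducible_of_comp (f := QuotientGroup.mk' N) hρ, rfl⟩

theorem exists_isIrreducible_twist_comp_mk' {ρ : Representation k G V} (hρ : ρ.IsIrreducible)
    {κ : G →* kˣ} (h : weightSpace (resRep ρ N) (κ.comp N.subtype) = ⊤) :
    ∃ σ : Representation k (G ⧸ N) V,
      σ.IsIrreducible ∧ ρ = twist (MonoidHom.comp σ (QuotientGroup.mk' N)) κ := by
  have htop := weightSpace_twist (resRep ρ N) (κ.comp N.subtype)⁻¹ (κ.comp N.subtype)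
  rw [inv_mul_cancel (κ.comp N.subtype), h] at htop
  obtain ⟨σ, hσ, heq⟩ := exists_isIrreducible_comp_mk' (isIrreducible_twist hρ κ⁻¹) htop
  exact ⟨σ, hσ, by rw [← heq, twist_twist, inv_mul_cancel κ, twist_one]⟩

end Descent

section PGroup

variable {k V : Type*} [Field k] [IsAlgClosed k] [AddCommGroup V] [Module k V]
  [FiniteDimensional k V]

theorem exists_weightSpace_center_eq_top {G : Type*} [Group G] {ρ : Representation k G V}
    (hρ : ρ.IsIrreducible) :
    ∃ μ : Subgroup.center G →* kˣ, weightSpace (resRep ρ (Subgroup.center G)) μ = ⊤ := by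
  have hρ' := (isIrreducible_iff ρ).1 hρ
  have := hρ'.1
  have scalar (z : Subgroup.center G) : ∃ c : k, ∀ v, ρ z v = c • v := by
    obtain ⟨c, hc⟩ := Module.End.exists_eigenvalue (ρ z)
    refine ⟨c, fun v => Module.End.mem_eigenspace_iff.1 ?_⟩
    rw [(hρ'.2 (Module.End.eigenspace (ρ z) c) fun g w hw => ?_).resolve_left hc]
    · exact Submodule.mem_top
    · rw [Module.End.mem_eigenspace_iff] at hw ⊢
      rw [← Module.End.mul_apply, ← map_mul, ← Subgroup.mem_center_iff.1 z.2 g, map_mul,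
        Module.End.mul_apply, hw, map_smul]
  choose c hc using scalar
  obtain ⟨v, hv⟩ := exists_ne (0 : V)
  obtain ⟨μ, hμ⟩ := exists_mem_weightSpace (ρ := resRep ρ (Subgroup.center G)) hv
    fun z => ⟨c z, hc z v⟩
  refine ⟨μ, Submodule.eq_top_iff'.2 fun w z => ?_⟩
  have hcz : c z = μ z := smul_left_injective k hv ((hc z v).symm.trans (hμ z))
  exact hcz ▸ hc z w

theorem finrank_eq_one_of_isPGroup {p : ℕ} [Fact p.Prime] {P : Type*} [Group P] [Finite P]
    (hP : IsPGroup p P) {ρ : Representation k P V} (hρ : ρ.IsIrreducible)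
    (hV : ¬ p ∣ Module.finrank k V) : Module.finrank k V = 1 := by
  induction hn : Nat.card P using Nat.strong_induction_on generalizing P with
  | h n ih =>
  rcases subsingleton_or_nontrivial P with hsub | hnt
  · exact IsIrreducible.finrank_eq_one_of_isMulCommutative ρ
  have := hP.center_nontrivial
  obtain ⟨μ, hμ⟩ := exists_weightSpace_center_eq_top hρ
  obtain ⟨κ, rfl⟩ := exists_extension_of_weightSpace_eq_top (hP.to_subgroup _) hV hμ
  obtain ⟨σ, hσ, rfl⟩ := exists_isIrreducible_twist_comp_mk' hρ hμ
  exact ih _ (hn ▸ card_quotient_lt ((Subgroup.nontrivial_iff_ne_bot _).1 this))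
    (hP.to_quotient _) hσ rfl

end PGroup

section Solvable

variable {p : ℕ} {G H : Type*} [Group G] [Group H]

theorem IsPSolvable.exists_normal [Nontrivial G] (h : IsPSolvable p G) :
    ∃ N : Subgroup G, N.Normal ∧ N ≠ ⊥ ∧ (IsPGroup p N ∨ (Nat.card N).Coprime p) := by
  classical
  obtain ⟨n, N, h0, hn, hnorm, hN⟩ := h
  have hntop : N n ≠ ⊥ := hn ▸ top_ne_bot
  have hex : ∃ i, N i ≠ ⊥ := ⟨n, hntop⟩
  obtain ⟨i, hi⟩ : ∃ i, Nat.find hex = i + 1 :=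
    Nat.exists_eq_succ_of_ne_zero fun h => Nat.find_spec hex (h ▸ h0)
  have hbot : N i = ⊥ := not_not.1 (Nat.find_min hex (by lia))
  obtain ⟨-, hidx⟩ := hN i (by have := Nat.find_min' hex hntop; lia)
  refine ⟨N (i + 1), hnorm _, hi ▸ Nat.find_spec hex, ?_⟩
  rw [hbot, Subgroup.relIndex_bot_left] at hidx
  exact hidx.imp_left fun ⟨k, hk⟩ => IsPGroup.of_card hk

variable [Fact p.Prime]

theorem primePow_or_coprime_of_dvd {a b : ℕ} (hab : a ∣ b)
    (hb : (∃ k, b = p ^ k) ∨ b.Coprime p) : (∃ k, a = p ^ k) ∨ a.Coprime p := by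
  rcases hb with ⟨k, rfl⟩ | h
  · obtain ⟨j, -, hj⟩ := (Nat.dvd_prime_pow Fact.out).1 hab
    exact Or.inl ⟨j, hj⟩
  · exact Or.inr (h.coprime_dvd_left hab)

theorem IsPSolvable.subgroup (h : IsPSolvable p G) (T : Subgroup G) : IsPSolvable p T := by
  obtain ⟨n, N, h0, hn, hnorm, hN⟩ := h
  refine ⟨n, fun i => (N i).subgroupOf T, by simp [h0], by simp [hn],
    fun i => (hnorm i).subgroupOf T, fun i hi => ?_⟩
  obtain ⟨hle, hidx⟩ := hN i hi
  refine ⟨Subgroup.comap_mono hle, primePow_or_coprime_of_dvd ?_ hidx⟩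
  have hle' : ((N (i + 1)).subgroupOf T).map T.subtype ≤ N (i + 1) := Subgroup.map_comap_le _ _
  have := hnorm i
  change ((N i).comap T.subtype).relIndex _ ∣ _
  rw [Subgroup.relIndex_comap, ← Subgroup.relIndex_subgroupOf hle']
  exact Subgroup.relIndex_dvd_index_of_normal _ _

theorem IsPSolvable.map (h : IsPSolvable p G) (f : G →* H) (hf : Function.Surjective f) :
    IsPSolvable p H := by
  obtain ⟨n, N, h0, hn, hnorm, hN⟩ := h
  refine ⟨n, fun i => (N i).map f, by simp [h0], ?_, fun i => (hnorm i).map f hf, fun i hi => ?_⟩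
  · change (N n).map f = ⊤
    rw [hn, ← MonoidHom.range_eq_map, MonoidHom.range_eq_top.2 hf]
  · obtain ⟨hle, hidx⟩ := hN i hi
    refine ⟨Subgroup.map_mono hle, primePow_or_coprime_of_dvd ?_ hidx⟩
    have := hnorm i
    have hsup : N (i + 1) ⊔ f.ker = N (i + 1) ⊔ (N i ⊔ f.ker) := by
      rw [← sup_assoc, sup_eq_left.2 hle]
    rw [Subgroup.relIndex_map_map, hsup, Subgroup.relIndex_sup_right]
    exact Subgroup.relIndex_dvd_of_le_left _ le_sup_left

end Solvable

section ConjBy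

variable {G H : Type*} [Group G] [Group H] {P Q : Subgroup G} {g h x : G}

theorem mem_conjBy : x ∈ conjBy P g ↔ g * x * g⁻¹ ∈ P := by
  rw [conjBy, Subgroup.mem_map]
  constructor
  · rintro ⟨y, hy, rfl⟩
    simpa [mul_assoc] using hy
  · intro h
    exact ⟨_, h, by simp [mul_assoc]⟩

theorem conjBy_mul : conjBy P (g * h) = conjBy (conjBy P g) h := by
  ext x
  simp only [mem_conjBy, mul_inv_rev, mul_assoc]

theorem conjBy_le_conjBy_iff : conjBy Q g ≤ conjBy P h ↔ Q ≤ conjBy P (h * g⁻¹) := by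
  constructor <;> intro hle x hx
  · have := @hle (g⁻¹ * x * g) (mem_conjBy.2 (by simpa [mul_assoc] using hx))
    simpa [mem_conjBy, mul_assoc] using this
  · simpa [mem_conjBy, mul_assoc] using hle (mem_conjBy.1 hx)

theorem map_conjBy (f : G →* H) : (conjBy P g).map f = conjBy (P.map f) (f g) := by
  rw [conjBy, conjBy, Subgroup.map_map, Subgroup.map_map]
  congr 1
  ext x
  simp

theorem conjBy_eq_iff : conjBy P g = P ↔ g ∈ Subgroup.normalizer (P : Set G) := by
  rw [Subgroup.mem_normalizer_iff, SetLike.ext_iff]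
  simp only [mem_conjBy]
  exact forall_congr' fun x => Iff.comm

theorem conjBy_of_mem (hg : g ∈ P) : conjBy P g = P :=
  conjBy_eq_iff.2 (Subgroup.le_normalizer hg)

theorem conjBy_eq_of_le [Finite P] (hle : P ≤ conjBy P g) : conjBy P g = P :=
  conjBy_eq_iff.2 (Subgroup.mem_normalizer_fintype fun _ hx => mem_conjBy.1 (hle hx))

theorem isPicky_top [Finite P] : IsPicky P ⊤ := by
  intro g hg
  rw [← MonoidHom.range_eq_map, Subgroup.range_subtype] at hg
  exact conjBy_eq_of_le hg

theorem not_isPicky_subgroupOf {T : Subgroup G} (hPT : P ≤ T)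
    {Q : Subgroup (P.subgroupOf T)} (hQ : ¬ IsPicky (P.subgroupOf T) Q) :
    ¬ IsPicky P (Q.comap (Subgroup.subgroupOfEquivOfLe hPT).symm.toMonoidHom) := by
  refine fun hpicky => hQ fun t ht => ?_
  have hconj := hpicky t (by
    rintro _ ⟨q, hq, rfl⟩
    exact mem_conjBy.2 (Subgroup.mem_subgroupOf.1 (mem_conjBy.1 (ht ⟨_, hq, rfl⟩))))
  ext x
  rw [mem_conjBy, Subgroup.mem_subgroupOf, Subgroup.mem_subgroupOf]
  have hx := SetLike.ext_iff.1 hconj (x : G)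
  rwa [mem_conjBy] at hx

end ConjBy

section Sylow

variable {p : ℕ} {G H : Type*} [Group G] [Group H]

/-- `P` is a Sylow `p`-subgroup of `G` that equals its own normalizer. This is stated for an
arbitrary subgroup, rather than for `P : Sylow p G`, because `P` has to be moved to quotients and
subgroups of `G`. -/
structure IsSelfNormalizingSylow (p : ℕ) (P : Subgroup G) : Prop where
  isPGroup : IsPGroup p P
  not_dvd_index : ¬ p ∣ P.index
  normalizer_eq : Subgroup.normalizer (P : Set G) = P

variable {P : Subgroup G}

theorem IsSelfNormalizingSylow.mem_of_conjBy_eq (hP : IsSelfNormalizingSylow p P) {g : G}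
    (hg : conjBy P g = P) : g ∈ P := by
  rwa [conjBy_eq_iff, hP.normalizer_eq] at hg

theorem IsSelfNormalizingSylow.subgroupOf (hP : IsSelfNormalizingSylow p P) {T : Subgroup G}
    (hPT : P ≤ T) :
    IsSelfNormalizingSylow p (P.subgroupOf T) where
  isPGroup := hP.isPGroup.comap_subtype
  not_dvd_index h := hP.not_dvd_index (h.trans (Subgroup.relIndex_dvd_index_of_le hPT))
  normalizer_eq := by
    refine le_antisymm (fun t ht => ?_) Subgroup.le_normalizer
    rw [← conjBy_eq_iff] at ht
    refine Subgroup.mem_subgroupOf.2 (hP.mem_of_conjBy_eq ?_)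
    have hmap := congrArg (Subgroup.map T.subtype) ht
    rwa [map_conjBy, Subgroup.map_subgroupOf_eq_of_le hPT] at hmap

variable [Fact p.Prime] [Finite G]

theorem exists_le_conjBy {A Q : Subgroup G} (hP : IsPGroup p P) (hidx : ¬ p ∣ P.index)
    (hPA : P ≤ A) (hQ : IsPGroup p Q) (hQA : Q ≤ A) : ∃ a ∈ A, Q ≤ conjBy P a := by
  let S : Sylow p A := (hP.toSylow hidx).subtype hPA
  obtain ⟨R, hR⟩ := (hQ.comap_subtype : IsPGroup p (Q.subgroupOf A)).exists_le_sylow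
  obtain ⟨a, ha⟩ := MulAction.exists_smul_eq A R S
  refine ⟨a, a.2, fun q hq => mem_conjBy.2 ?_⟩
  have hqS : a * ⟨q, hQA hq⟩ * a⁻¹ ∈ S := by
    rw [← ha, ← SetLike.mem_coe, Sylow.coe_smul]
    exact ⟨_, hR (Subgroup.mem_subgroupOf.2 hq), rfl⟩
  exact Subgroup.mem_subgroupOf.1 hqS

namespace IsSelfNormalizingSylow

/-- For `Q ≤ P ^ f g` in the quotient, the preimages of `Q` and of `P ^ f g` both lie in the
preimage of `P.map f` up to conjugation by `g`, and `P` is a Sylow subgroup there. -/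
theorem exists_le_conjBy_of_map_le {f : G →* H} {Q : Subgroup G} {g : G}
    (hP : IsSelfNormalizingSylow p P) (hQ : IsPGroup p Q)
    (hle : Q.map f ≤ conjBy (P.map f) (f g)) :
    ∃ a, f a ∈ P.map f ∧ Q ≤ conjBy P (a * g) := by
  obtain ⟨a, ha, haQ⟩ := exists_le_conjBy (A := (P.map f).comap f) (Q := conjBy Q g⁻¹)
    hP.isPGroup hP.not_dvd_index (Subgroup.le_comap_map f P) (hQ.map _) <| by
      rw [← Subgroup.map_le_iff_le_comap, map_conjBy]
      have := (conjBy_le_conjBy_iff (Q := Q.map f) (P := P.map f) (g := (f g)⁻¹) (h := 1)).2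
      simpa [conjBy_of_mem (one_mem _)] using this (by simpa using hle)
  exact ⟨a, ha, by simpa [conjBy_le_conjBy_iff] using haQ⟩

theorem map (hP : IsSelfNormalizingSylow p P) {f : G →* H} (hf : Function.Surjective f) :
    IsSelfNormalizingSylow p (P.map f) where
  isPGroup := hP.isPGroup.map f
  not_dvd_index h := hP.not_dvd_index (h.trans (P.index_map_dvd hf))
  normalizer_eq := by
    refine le_antisymm (fun h hh => ?_) Subgroup.le_normalizer
    obtain ⟨g, rfl⟩ := hf h
    rw [← conjBy_eq_iff] at hh
    obtain ⟨a, ha, hle⟩ := hP.exists_le_conjBy_of_map_le hP.isPGroup hh.ge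
    have hag := Subgroup.mem_map_of_mem f (hP.mem_of_conjBy_eq (conjBy_eq_of_le hle))
    rw [map_mul] at hag
    exact (Subgroup.mul_mem_cancel_left _ ha).1 hag

theorem not_isPicky_comap (hP : IsSelfNormalizingSylow p P) {f : G →* H}
    (hf : Function.Surjective f) {Q : Subgroup (P.map f)} (hQ : ¬ IsPicky (P.map f) Q) :
    ¬ IsPicky P (Q.comap (f.subgroupMap P)) := by
  refine fun hpicky => hQ fun h hh => ?_
  obtain ⟨g, rfl⟩ := hf h
  obtain ⟨a, ha, hle⟩ := hP.exists_le_conjBy_of_map_le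
    ((hP.isPGroup.to_subgroup (Q.comap (f.subgroupMap P))).map P.subtype) <| by
      refine le_trans ?_ hh
      rintro _ ⟨_, ⟨q, hq, rfl⟩, rfl⟩
      exact ⟨_, hq, rfl⟩
  calc conjBy (P.map f) (f g)
    _ = conjBy (conjBy (P.map f) (f a)) (f g) := by rw [conjBy_of_mem ha]
    _ = (conjBy P (a * g)).map f := by rw [← conjBy_mul, map_conjBy, map_mul]
    _ = P.map f := by rw [hpicky _ hle]

/-- A subgroup `Q` of `P` fixing `g • y` satisfies `Q ^ g ≤ Stab y`, so `Q ^ g ≤ P ^ a` for some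
`a` fixing `y` by Sylow's theorem in the stabilizer; if `Q` is picky, then `a * g⁻¹ ∈ P`. -/
theorem not_isPicky_of_smul_eq (hP : IsSelfNormalizingSylow p P) {Y : Type*} [MulAction G Y]
    {y z : Y} (hy : ∀ x ∈ P, x • y = y) (hz : z ∈ MulAction.orbit G y) (hne : z ≠ y)
    {Q : Subgroup P} (hQ : ∀ q ∈ Q, q • z = z) : ¬ IsPicky P Q := by
  obtain ⟨g, rfl⟩ := hz
  refine fun hpicky => hne ?_
  obtain ⟨a, ha, hle⟩ := exists_le_conjBy (A := MulAction.stabilizer G y)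
    (Q := conjBy (Q.map P.subtype) g) hP.isPGroup hP.not_dvd_index hy
    (((hP.isPGroup.to_subgroup Q).map P.subtype).map _) fun x hx => by
      obtain ⟨q, hq, hqx⟩ := mem_conjBy.1 hx
      have hfix : (q : G) • g • y = g • y := hQ q hq
      rw [show (q : G) = g * x * g⁻¹ from hqx, mul_smul, inv_smul_smul, mul_smul] at hfix
      exact smul_left_cancel g hfix
  have hag := hy _ (hP.mem_of_conjBy_eq (hpicky _ (conjBy_le_conjBy_iff.1 hle)))
  have hg : g⁻¹ • y = y := by
    rw [mul_smul, ← eq_inv_smul_iff] at hag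
    rw [hag, inv_smul_eq_iff, MulAction.mem_stabilizer_iff.1 ha]
  exact (inv_smul_eq_iff.1 hg).symm

theorem eq_of_smul_eq_of_mem_orbit (hP : IsSelfNormalizingSylow p P) {Y : Type*} [MulAction G Y]
    {y z : Y} (hy : ∀ x ∈ P, x • y = y) (hz : z ∈ MulAction.orbit G y)
    (hz' : ∀ x ∈ P, x • z = z) : z = y := by
  by_contra hne
  exact hP.not_isPicky_of_smul_eq hy hz hne (Q := ⊤) (fun q _ => hz' q q.2) isPicky_top

end IsSelfNormalizingSylow

end Sylow

section Transport

section

variable {P R : Type*} [Group P] [Group R]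

theorem IsCharacterOrZero.comp {f : R → ℂ} (hf : IsCharacterOrZero f) (φ : P →* R) :
    IsCharacterOrZero fun x => f (φ x) := by
  obtain ⟨n, ρ, rfl⟩ := hf
  exact ⟨n, MonoidHom.comp ρ φ, rfl⟩

theorem IsCharacterOrZero.twist {f : P → ℂ} (hf : IsCharacterOrZero f) (ν : P →* ℂˣ) :
    IsCharacterOrZero fun x => ν x * f x := by
  obtain ⟨n, ρ, rfl⟩ := hf
  exact ⟨n, EvseevPicky.twist ρ ν, funext fun g => (character_twist ρ ν g).symm⟩

theorem sum_comp_eq_card_ker_nsmul [Fintype P] [Fintype R] {φ : P →* R}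
    (hφ : Function.Surjective φ) {A : Type*} [AddCommMonoid A] (F : R → A) :
    ∑ x, F (φ x) = Nat.card φ.ker • ∑ y, F y := by
  classical
  rw [Finset.sum_comp F φ, Finset.image_univ_of_surjective hφ, Finset.smul_sum]
  refine Finset.sum_congr rfl fun y _ => ?_
  rw [MonoidHom.card_fiber_eq_of_mem_range φ (hφ y) (hφ 1), ← Fintype.card_subtype,
    ← Nat.card_eq_fintype_card]
  congr 1

variable [Finite P]

theorem card_comap_eq_card_ker_mul {φ : P →* R} (hφ : Function.Surjective φ) (Q : Subgroup R) :
    Nat.card (Q.comap φ) = Nat.card φ.ker * Nat.card Q := by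
  have hR : φ.ker.index = Nat.card R := by
    rw [Subgroup.index_ker, MonoidHom.range_eq_top.2 hφ, Subgroup.card_top]
  have hQ : Q.index ≠ 0 := by
    rw [← Q.index_comap_of_surjective hφ]
    exact Subgroup.index_ne_zero_of_finite
  refine mul_right_cancel₀ hQ ?_
  rw [mul_assoc, Q.card_mul_index, ← hR, φ.ker.card_mul_index, ← Q.index_comap_of_surjective hφ,
    Subgroup.card_mul_index]

theorem ind_comap [Finite R] {φ : P →* R} (hφ : Function.Surjective φ) (Q : Subgroup R)
    (θ : Q → ℂ) (x : P) : ind (Q.comap φ) (fun q => θ ⟨φ q, q.2⟩) x = ind Q θ (φ x) := by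
  have := Fintype.ofFinite P
  have := Fintype.ofFinite R
  obtain ⟨F, hF, rfl⟩ := exists_extend_zero Q θ
  have hker : (Nat.card φ.ker : ℂ) ≠ 0 := Nat.cast_ne_zero.2 Nat.card_pos.ne'
  rw [ind_apply hF, ind_apply (θ := fun x => F (φ x)) fun x hx => hF _ hx]
  simp_rw [map_mul, map_inv]
  rw [sum_comp_eq_card_ker_nsmul hφ fun y => F (y⁻¹ * φ x * y), card_comap_eq_card_ker_mul hφ,
    nsmul_eq_mul, Nat.cast_mul, mul_inv_rev, mul_assoc, inv_mul_cancel_left₀ hker]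

theorem ind_twist (Q : Subgroup P) (θ : Q → ℂ) (ν : P →* ℂˣ) (x : P) :
    ind Q (fun q => ν q * θ q) x = ν x * ind Q θ x := by
  have := Fintype.ofFinite P
  obtain ⟨F, hF, rfl⟩ := exists_extend_zero Q θ
  have hν (y : P) : ν (y⁻¹ * x * y) = ν x := by
    rw [map_mul, map_mul, map_inv, mul_comm, mul_inv_cancel_left]
  rw [ind_apply hF, ind_apply (θ := fun x => ν x * F x) fun x hx => by rw [hF x hx, mul_zero]]
  simp_rw [hν]
  rw [← Finset.mul_sum, mul_left_comm]

end

variable {G H : Type*} [Group G] [Finite G] [Group H] [Finite H] {P : Subgroup G}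

theorem sumsIndNonPicky_comp {R : Subgroup H} {φ : P →* R} (hφ : Function.Surjective φ)
    (hpicky : ∀ Q : Subgroup R, ¬ IsPicky R Q → ¬ IsPicky P (Q.comap φ)) {Δ : R → ℂ}
    (hΔ : Δ ∈ sumsIndNonPicky R) : (fun x => Δ (φ x)) ∈ sumsIndNonPicky P := by
  unfold sumsIndNonPicky at hΔ
  induction hΔ using AddSubmonoid.closure_induction with
  | mem f hf =>
    obtain ⟨Q, θ, hQ, hθ, rfl⟩ := hf
    exact AddSubmonoid.subset_closure ⟨Q.comap φ, _, hpicky Q hQ,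
      hθ.comp ((φ.comp (Q.comap φ).subtype).codRestrict Q fun q => q.2),
      funext fun x => (ind_comap hφ Q θ x).symm⟩
  | zero => exact zero_mem _
  | add f g _ _ hf hg => exact add_mem hf hg

theorem sumsIndNonPicky_twist (ν : P →* ℂˣ) {Δ : P → ℂ} (hΔ : Δ ∈ sumsIndNonPicky P) :
    (fun x => ν x * Δ x) ∈ sumsIndNonPicky P := by
  unfold sumsIndNonPicky at hΔ
  induction hΔ using AddSubmonoid.closure_induction with
  | mem f hf =>
    obtain ⟨Q, θ, hQ, hθ, rfl⟩ := hf
    exact AddSubmonoid.subset_closure ⟨Q, _, hQ, hθ.twist (ν.comp Q.subtype),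
      funext fun x => (ind_twist Q θ ν x).symm⟩
  | zero =>
    simp only [Pi.zero_apply, mul_zero]
    exact zero_mem _
  | add f g _ _ hf hg =>
    simp only [Pi.add_apply, mul_add]
    exact add_mem hf hg

end Transport

section Coprime

variable {p : ℕ} {G V : Type*} [Group G] [AddCommGroup V] [Module ℂ V] [FiniteDimensional ℂ V]

theorem isIntegral_character [Finite G] (ρ : Representation ℂ G V) (g : G) :
    IsIntegral ℤ (ρ.character g) := by
  rw [character, Module.End.trace_eq_sum_roots_charpoly_of_splits (IsAlgClosed.splits _)]
  refine IsIntegral.multiset_sum fun c hc => IsIntegral.of_pow (orderOf_pos g) ?_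
  have hev : Module.End.HasEigenvalue (ρ g) c :=
    (Module.End.hasEigenvalue_iff_isRoot_charpoly _ _).2 (Polynomial.isRoot_of_mem_roots hc)
  obtain ⟨v, hv⟩ := (hev.pow (orderOf g)).exists_hasEigenvector
  have hroot := hv.apply_eq_smul
  rw [← map_pow, pow_orderOf_eq_one, map_one, Module.End.one_apply] at hroot
  have hone : c ^ orderOf g = 1 := smul_left_injective ℂ hv.2 (by simpa using hroot.symm)
  exact hone ▸ isIntegral_one

theorem dvd_of_eq_mul_of_isIntegral (hp : p ≠ 0) {n : ℕ} {r : ℂ} (hr : IsIntegral ℤ r)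
    (h : (n : ℂ) = p * r) : p ∣ n := by
  have hp' : (p : ℚ) ≠ 0 := Nat.cast_ne_zero.2 hp
  have hrat : r = algebraMap ℚ ℂ (n / p) := by
    rw [map_div₀, map_natCast, map_natCast, h, mul_div_cancel_left₀ _ (Nat.cast_ne_zero.2 hp)]
  rw [hrat, isIntegral_algebraMap_iff (algebraMap ℚ ℂ).injective] at hr
  obtain ⟨y, hy⟩ := IsIntegrallyClosed.isIntegral_iff.1 hr
  rw [eq_div_iff hp', eq_intCast] at hy
  exact_mod_cast Dvd.intro_left y (by exact_mod_cast hy : y * (p : ℤ) = n)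

variable {P K : Subgroup G}

theorem IsSelfNormalizingSylow.eq_one_of_forall_conj_eq [Finite G]
    (hP : IsSelfNormalizingSylow p P) (hK : (Nat.card K).Coprime p) {x : G} (hxK : x ∈ K)
    (hx : ∀ y ∈ P, y * x * y⁻¹ = x) : x = 1 := by
  have hxP : x ∈ P := hP.mem_of_conjBy_eq <| conjBy_eq_iff.2 <|
    Subgroup.mem_normalizer_fintype fun y hy => by
      rwa [← mul_inv_eq_iff_eq_mul.1 (hx y hy), mul_inv_cancel_right]
  have hcop := hP.isPGroup.orderOf_coprime hK.symm ⟨x, hxP⟩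
  rw [Subgroup.orderOf_mk] at hcop
  exact orderOf_eq_one_iff.1 <| hcop.eq_one_of_dvd <| by
    simpa only [Subgroup.orderOf_mk] using orderOf_dvd_natCard (⟨x, hxK⟩ : K)

variable [Fact p.Prime] [Finite G] [K.Normal]

theorem exists_sum_character_sub_finrank_eq_mul [Fintype K] (hP : IsSelfNormalizingSylow p P)
    (hK : (Nat.card K).Coprime p) (ρ : Representation ℂ G V) :
    ∃ r, IsIntegral ℤ r ∧ ∑ x : K, ρ.character x - Module.finrank ℂ V = p * r := by
  let _ : MulAction P K := .compHom K ((MulAut.conjNormal : G →* MulAut K).comp P.subtype)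
  have hsmul (g : P) (x : K) : ((g • x : K) : G) = g * x * (g : G)⁻¹ := rfl
  have hfixed : MulAction.fixedPoints P K = {1} := by
    refine Set.Subset.antisymm (fun x hx => Subtype.ext ?_) ?_
    · exact hP.eq_one_of_forall_conj_eq hK x.2 fun y hy => congrArg Subtype.val (hx ⟨y, hy⟩)
    · rintro _ rfl g
      exact Subtype.ext (by simp [hsmul])
  let f : K → integralClosure ℤ ℂ := fun x => ⟨ρ.character x, isIntegral_character ρ x⟩
  have hf (g : P) (x : K) : f (g • x) = f x :=
    Subtype.ext (by simp only [f, hsmul, char_conj])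
  obtain ⟨r, hr⟩ := dvd_sum_sub_of_fixedPoints_eq_singleton hP.isPGroup hfixed f hf
  refine ⟨r, r.2, ?_⟩
  simpa [f] using congrArg (algebraMap (integralClosure ℤ ℂ) ℂ) hr

theorem invariants_ne_bot_of_coprime (hP : IsSelfNormalizingSylow p P)
    (hK : (Nat.card K).Coprime p) {ρ : Representation ℂ G V} (hV : ¬ p ∣ Module.finrank ℂ V) :
    (resRep ρ K).invariants ≠ ⊥ := by
  intro hbot
  have := Fintype.ofFinite K
  have hcard : (Nat.card K : ℂ) ≠ 0 := Nat.cast_ne_zero.2 Nat.card_pos.ne'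
  have := invertibleOfNonzero hcard
  have hsum := (resRep ρ K).card_inv_mul_sum_char_eq_finrank
  rw [hbot, finrank_bot, Nat.cast_zero, mul_eq_zero, or_iff_right (inv_ne_zero hcard)] at hsum
  change ∑ x : K, ρ.character x = 0 at hsum
  obtain ⟨r, hr, h⟩ := exists_sum_character_sub_finrank_eq_mul hP hK ρ
  rw [hsum, zero_sub, neg_eq_iff_eq_neg, ← mul_neg] at h
  exact hV (dvd_of_eq_mul_of_isIntegral (NeZero.ne p) hr.neg h)

theorem weightSpace_one_eq_top_of_coprime (hP : IsSelfNormalizingSylow p P)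
    (hK : (Nat.card K).Coprime p) {ρ : Representation ℂ G V} (hρ : ρ.IsIrreducible)
    (hV : ¬ p ∣ Module.finrank ℂ V) : weightSpace (resRep ρ K) 1 = ⊤ := by
  have hinv : weightSpace (resRep ρ K) 1 = (resRep ρ K).invariants := by
    ext v
    simp [mem_weightSpace, mem_invariants]
  rw [hinv]
  exact (((isIrreducible_iff ρ).1 hρ).2 _ fun g v hv => le_comap_invariants ρ K g hv).resolve_left
    (invariants_ne_bot_of_coprime hP hK hV)

end Coprime

section Constituents

variable {k G H V : Type*} [Field k] [Group G] [Group H] [AddCommGroup V] [Module k V]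

theorem weightSpace_comp (ρ : Representation k H V) {φ : G →* H} (hφ : Function.Surjective φ)
    (ν : H →* kˣ) : weightSpace (MonoidHom.comp ρ φ) (ν.comp φ) = weightSpace ρ ν := by
  ext v
  exact (hφ.forall (p := fun h => ρ h v = (ν h : k) • v)).symm

theorem exists_eq_comp_of_weightSpace_ne_bot {ρ : Representation k H V} {φ : G →* H}
    (hφ : Function.Surjective φ) {ν : G →* kˣ} (h : weightSpace (MonoidHom.comp ρ φ) ν ≠ ⊥) :
    ∃ ν' : H →* kˣ, ν = ν'.comp φ := by
  obtain ⟨v, hv, hv0⟩ := Submodule.exists_mem_ne_zero_of_ne_bot h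
  obtain ⟨ν', hν'⟩ := exists_mem_weightSpace (ρ := ρ) hv0 <|
    hφ.forall.2 fun g => ⟨ν g, hv g⟩
  exact ⟨ν', eq_of_mem_weightSpace hv0 hv (weightSpace_comp ρ hφ ν' ▸ hν')⟩

theorem character_comp_eq_of_weightSpace_ne_bot {V' : Type*} [AddCommGroup V'] [Module k V']
    {P : Subgroup G} {φ : G →* H} {ρ : Representation k H V} {ρ' : Representation k H V'}
    (h : ∀ ν, weightSpace (resRep ρ (P.map φ)) ν ≠ ⊥ → weightSpace (resRep ρ' (P.map φ)) ν ≠ ⊥ →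
      ρ.character = ρ'.character) {ν : P →* kˣ}
    (hν : weightSpace (resRep (MonoidHom.comp ρ φ) P) ν ≠ ⊥)
    (hν' : weightSpace (resRep (MonoidHom.comp ρ' φ) P) ν ≠ ⊥) :
    character (MonoidHom.comp ρ φ) = character (MonoidHom.comp ρ' φ) := by
  have hφP := φ.subgroupMap_surjective P
  obtain ⟨ν, rfl⟩ := exists_eq_comp_of_weightSpace_ne_bot (ρ := resRep ρ (P.map φ)) hφP hν
  have hχ := h ν (weightSpace_comp (resRep ρ (P.map φ)) hφP ν ▸ hν)
    (weightSpace_comp (resRep ρ' (P.map φ)) hφP ν ▸ hν')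
  exact congrArg (· ∘ φ) hχ

variable {N P : Subgroup G} {ρ : Representation k G V}

theorem weightSpace_resRep_le (hNP : N ≤ P) (ν : P →* kˣ) :
    weightSpace (resRep ρ P) ν ≤ weightSpace (resRep ρ N) (ν.comp (Subgroup.inclusion hNP)) :=
  fun _ hv n => hv (Subgroup.inclusion hNP n)

theorem weightSpace_resRep_twist (κ : G →* kˣ) (ν : P →* kˣ) :
    weightSpace (resRep (twist ρ κ) P) ν =
      weightSpace (resRep ρ P) ((κ.comp P.subtype)⁻¹ * ν) := by
  have h := weightSpace_twist (resRep ρ P) (κ.comp P.subtype) ((κ.comp P.subtype)⁻¹ * ν)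
  rwa [mul_inv_cancel_left (κ.comp P.subtype)] at h

variable [N.Normal]

theorem smul_comp_inclusion (hNP : N ≤ P) (ν : P →* kˣ) {x : G} (hx : x ∈ P) :
    x • ν.comp (Subgroup.inclusion hNP) = ν.comp (Subgroup.inclusion hNP) := by
  ext n
  have hconj : Subgroup.inclusion hNP (MulAut.conjNormal x⁻¹ n) =
      (⟨x, hx⟩ : P)⁻¹ * Subgroup.inclusion hNP n * ⟨x, hx⟩ := by
    ext
    simp
  rw [conj_smul_apply, MonoidHom.comp_apply, hconj, map_mul, map_mul, map_inv, mul_comm,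
    mul_inv_cancel_left, MonoidHom.comp_apply]

theorem weightSpace_eq_top_of_stabilizer_eq_top (hρ : ρ.IsIrreducible) {μ : N →* kˣ}
    (hμ : weightSpace (resRep ρ N) μ ≠ ⊥) (h : MulAction.stabilizer G μ = ⊤) :
    weightSpace (resRep ρ N) μ = ⊤ := by
  refine (((isIrreducible_iff ρ).1 hρ).2 _ fun g v hv => ?_).resolve_left hμ
  have hg : g • μ = μ := MulAction.mem_stabilizer_iff.1 (h ▸ Subgroup.mem_top g)
  exact hg ▸ map_mem_weightSpace hv g

theorem weightSpace_stabRep {μ : N →* kˣ} (hPμ : P ≤ MulAction.stabilizer G μ) (ν : P →* kˣ) :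
    weightSpace (resRep (stabRep ρ μ) (P.subgroupOf (MulAction.stabilizer G μ)))
        (ν.comp (Subgroup.subgroupOfEquivOfLe hPμ).toMonoidHom) =
      (weightSpace (resRep ρ P) ν).comap (weightSpace (resRep ρ N) μ).subtype := by
  ext v
  refine ((Subgroup.subgroupOfEquivOfLe hPμ).surjective.forall.trans ?_).symm
  exact forall_congr' fun x => ⟨fun h => Subtype.ext h, fun h => congrArg Subtype.val h⟩

end Constituents

/-- The restriction of `ρ` to `P` has a unique linear constituent, and its character is this
linear character plus a sum of characters induced from non-picky subgroups. -/
def HasUniqueLinearConstituent {G V : Type*} [Group G] [AddCommGroup V] [Module ℂ V]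
    (P : Subgroup G) (ρ : Representation ℂ G V) : Prop :=
  ∃ lam : P →* ℂˣ, (∀ ν, weightSpace (resRep ρ P) ν ≠ ⊥ ↔ ν = lam) ∧
    ∃ Δ ∈ sumsIndNonPicky P, ∀ x : P, ρ.character x = lam x + Δ x

namespace HasUniqueLinearConstituent

variable {p : ℕ} {G H V : Type*} [Group G] [Group H] [AddCommGroup V] [Module ℂ V]
  {P : Subgroup G}

theorem of_subsingleton [Subsingleton G] [FiniteDimensional ℂ V] {ρ : Representation ℂ G V}
    (hρ : ρ.IsIrreducible) : HasUniqueLinearConstituent P ρ := by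
  have htop (ν : P →* ℂˣ) : weightSpace (resRep ρ P) ν = ⊤ :=
    Submodule.eq_top_iff'.2 fun v x => by simp [Subsingleton.elim x 1]
  have hV : Module.finrank ℂ V = 1 := IsIrreducible.finrank_eq_one_of_isMulCommutative ρ
  have := Module.nontrivial_of_finrank_eq_succ hV
  refine ⟨1, fun ν => iff_of_true (htop ν ▸ top_ne_bot) (Subsingleton.elim _ _), 0, zero_mem _,
    fun x => ?_⟩
  rw [Subsingleton.elim (x : G) 1, char_one, hV]
  simp

variable [Finite G]

theorem twist {ρ : Representation ℂ G V} (h : HasUniqueLinearConstituent P ρ) (κ : G →* ℂˣ) :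
    HasUniqueLinearConstituent P (twist ρ κ) := by
  obtain ⟨lam, hlam, Δ, hΔ, hχ⟩ := h
  refine ⟨κ.comp P.subtype * lam, fun ν => ?_, _, sumsIndNonPicky_twist (κ.comp P.subtype) hΔ,
    fun x => ?_⟩
  · rw [weightSpace_resRep_twist, hlam, inv_mul_eq_iff_eq_mul (a := κ.comp P.subtype)]
  · rw [character_twist, hχ, mul_add]
    simp

variable [Fact p.Prime] [Finite H]

theorem comp {f : G →* H} (hf : Function.Surjective f) (hP : IsSelfNormalizingSylow p P)
    {ρ : Representation ℂ H V} (h : HasUniqueLinearConstituent (P.map f) ρ) :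
    HasUniqueLinearConstituent P (MonoidHom.comp ρ f) := by
  obtain ⟨lam, hlam, Δ, hΔ, hχ⟩ := h
  have hfP := f.subgroupMap_surjective P
  refine ⟨lam.comp (f.subgroupMap P), fun ν => ⟨fun hν => ?_, ?_⟩, _,
    sumsIndNonPicky_comp hfP (fun Q => hP.not_isPicky_comap hf) hΔ,
    fun x => hχ (f.subgroupMap P x)⟩
  · obtain ⟨ν', rfl⟩ := exists_eq_comp_of_weightSpace_ne_bot (ρ := resRep ρ (P.map f)) hfP hν
    rw [(hlam ν').1 (weightSpace_comp (resRep ρ (P.map f)) hfP ν' ▸ hν)]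
  · rintro rfl
    exact (weightSpace_comp (resRep ρ (P.map f)) hfP lam).symm ▸ (hlam lam).2 rfl

end HasUniqueLinearConstituent

section CliffordSylow

variable {p : ℕ} [Fact p.Prime] {G V : Type*} [Group G] [Finite G] [AddCommGroup V] [Module ℂ V]
  {N P : Subgroup G} [N.Normal] {ρ : Representation ℂ G V} {μ : N →* ℂˣ}

theorem weightSpace_stabRep_ne_bot_iff (hP : IsSelfNormalizingSylow p P) (hNP : N ≤ P)
    (hρ : ρ.IsIrreducible) (hμ : weightSpace (resRep ρ N) μ ≠ ⊥)
    (hPμ : P ≤ MulAction.stabilizer G μ) (ν : P →* ℂˣ) :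
    weightSpace (resRep (stabRep ρ μ) (P.subgroupOf (MulAction.stabilizer G μ)))
        (ν.comp (Subgroup.subgroupOfEquivOfLe hPμ).toMonoidHom) ≠ ⊥ ↔
      weightSpace (resRep ρ P) ν ≠ ⊥ := by
  rw [weightSpace_stabRep, Ne, ← Submodule.disjoint_iff_comap_eq_bot, disjoint_iff]
  refine ⟨fun h => ne_bot_of_le_ne_bot h inf_le_right, fun h => ?_⟩
  have hle := weightSpace_resRep_le (ρ := ρ) hNP ν
  have hμν : ν.comp (Subgroup.inclusion hNP) = μ :=
    hP.eq_of_smul_eq_of_mem_orbit hPμ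
      (mem_orbit_of_weightSpace_ne_bot hρ hμ (ne_bot_of_le_ne_bot h hle))
      fun x hx => smul_comp_inclusion hNP ν hx
  rwa [← hμν, inf_eq_right.2 hle]

variable [FiniteDimensional ℂ V]

theorem isCharacterOrZero_weightCharacter (ρ : Representation ℂ G V)
    (b : MulAction.orbit G μ) :
    IsCharacterOrZero fun q : MulAction.stabilizer P b =>
      weightCharacter ρ (b : N →* ℂˣ) (q : P) := by
  let φ : MulAction.stabilizer P b →* MulAction.stabilizer G (b : N →* ℂˣ) :=
    (P.subtype.comp (MulAction.stabilizer P b).subtype).codRestrict _ fun q =>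
      congrArg Subtype.val q.2
  convert (isCharacterOrZero_character (stabRep ρ (b : N →* ℂˣ))).comp φ using 2 with q
  exact (character_stabRep (φ q)).symm

theorem sum_weightCharacter_mem_sumsIndNonPicky [DecidableEq (MulAction.orbit G μ)]
    [Fintype (MulAction.orbit G μ)] (hP : IsSelfNormalizingSylow p P)
    (ρ : Representation ℂ G V) (hPμ : P ≤ MulAction.stabilizer G μ) :
    (fun x : P => ∑ b ∈ Finset.univ.erase (⟨μ, MulAction.mem_orbit_self μ⟩ : MulAction.orbit G μ),
      weightCharacter ρ (b : N →* ℂˣ) x) ∈ sumsIndNonPicky P := by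
  have hconj (g x : P) (b : MulAction.orbit G μ) :
      weightCharacter ρ ((g • b : MulAction.orbit G μ) : N →* ℂˣ) ((g * x * g⁻¹ : P) : G) =
        weightCharacter ρ (b : N →* ℂˣ) x :=
    weightCharacter_conj ρ (b : N →* ℂˣ) (g : G) (x : G)
  refine sum_mem_of_ind_stabilizer_mem (P := P) (Y := MulAction.orbit G μ)
    (c := fun x b => weightCharacter ρ (b : N →* ℂˣ) x)
    (fun x b h => weightCharacter_eq_zero ρ fun hb => h (Subtype.ext hb))
    hconj _ (fun g b hb => ?_) fun b hb =>
    AddSubmonoid.subset_closure ⟨_, _, ?_, isCharacterOrZero_weightCharacter ρ b, rfl⟩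
  · simp only [Finset.mem_erase, Finset.mem_univ, and_true] at hb ⊢
    rintro h
    refine hb (smul_left_cancel g (h.trans (Subtype.ext ?_)))
    exact (hPμ g.2).symm
  · exact hP.not_isPicky_of_smul_eq hPμ b.2
      (fun h => Finset.ne_of_mem_erase hb (Subtype.ext h)) fun q hq => congrArg Subtype.val hq

theorem HasUniqueLinearConstituent.of_stabRep (hP : IsSelfNormalizingSylow p P) (hNP : N ≤ P)
    (hρ : ρ.IsIrreducible) (hμ : weightSpace (resRep ρ N) μ ≠ ⊥)
    (hPμ : P ≤ MulAction.stabilizer G μ)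
    (h : HasUniqueLinearConstituent (P.subgroupOf (MulAction.stabilizer G μ)) (stabRep ρ μ)) :
    HasUniqueLinearConstituent P ρ := by
  classical
  have := Fintype.ofFinite (MulAction.orbit G μ)
  obtain ⟨lam, hlam, Δ, hΔ, hχ⟩ := h
  let e := Subgroup.subgroupOfEquivOfLe hPμ
  refine ⟨lam.comp e.symm.toMonoidHom, fun ν => ?_, _,
    add_mem (sumsIndNonPicky_comp e.symm.surjective (fun Q => not_isPicky_subgroupOf hPμ) hΔ)
      (sum_weightCharacter_mem_sumsIndNonPicky hP ρ hPμ), fun x => ?_⟩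
  · rw [← weightSpace_stabRep_ne_bot_iff hP hNP hρ hμ hPμ, hlam]
    constructor
    · rintro rfl
      ext
      simp [e]
    · rintro rfl
      ext
      simp [e]
  · have hx := hχ (e.symm x)
    rw [character_stabRep] at hx
    change weightCharacter ρ μ x = _ at hx
    rw [character_eq_sum_weightCharacter hρ hμ, ← Finset.add_sum_erase _ _
      (Finset.mem_univ ⟨μ, MulAction.mem_orbit_self μ⟩), hx, add_assoc]
    rfl

theorem character_eq_of_character_stabRep_eq {V' : Type*} [AddCommGroup V'] [Module ℂ V']
    [FiniteDimensional ℂ V'] {ρ' : Representation ℂ G V'} (hρ : ρ.IsIrreducible)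
    (hρ' : ρ'.IsIrreducible) (hμ : weightSpace (resRep ρ N) μ ≠ ⊥)
    (hμ' : weightSpace (resRep ρ' N) μ ≠ ⊥)
    (h : (stabRep ρ μ).character = (stabRep ρ' μ).character) : ρ.character = ρ'.character := by
  have := Fintype.ofFinite (MulAction.orbit G μ)
  ext x
  rw [character_eq_sum_weightCharacter hρ hμ, character_eq_sum_weightCharacter hρ' hμ']
  refine Finset.sum_congr rfl ?_
  rintro ⟨_, g, rfl⟩ -
  change weightCharacter ρ (g • μ) x = weightCharacter ρ' (g • μ) x
  by_cases hx : x • g • μ = g • μ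
  · have hstab : g⁻¹ * x * g ∈ MulAction.stabilizer G μ := by
      rw [MulAction.mem_stabilizer_iff, mul_smul, mul_smul, hx, inv_smul_smul]
    have hχ := congrFun h ⟨_, hstab⟩
    rw [character_stabRep, character_stabRep, ← weightCharacter_conj ρ μ g,
      ← weightCharacter_conj ρ' μ g] at hχ
    simpa [mul_assoc] using hχ
  · rw [weightCharacter_eq_zero ρ hx, weightCharacter_eq_zero ρ' hx]

end CliffordSylow

section PSolvable

theorem not_dvd_finrank_weightSpace {p : ℕ} {G V : Type*} [Group G] [Finite G] [AddCommGroup V]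
    [Module ℂ V] [FiniteDimensional ℂ V] {N : Subgroup G} [N.Normal] {ρ : Representation ℂ G V}
    {μ : N →* ℂˣ} (hρ : ρ.IsIrreducible) (hμ : weightSpace (resRep ρ N) μ ≠ ⊥)
    (hV : ¬ p ∣ Module.finrank ℂ V) :
    ¬ p ∣ Module.finrank ℂ (weightSpace (resRep ρ N) μ) := fun h =>
  hV (finrank_eq_card_orbit_mul hρ hμ ▸ h.mul_left _)

variable {p : ℕ} [Fact p.Prime]

theorem IsPSolvable.induction {motive : ∀ (G : Type u) [Group G], Subgroup G → Prop}
    (subsingleton : ∀ (G : Type u) [Group G] [Subsingleton G] (P : Subgroup G), motive G P)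
    (coprime : ∀ (G : Type u) [Group G] [Finite G] (P N : Subgroup G) [N.Normal],
      IsSelfNormalizingSylow p P → (Nat.card N).Coprime p →
      motive (G ⧸ N) (P.map (QuotientGroup.mk' N)) → motive G P)
    (isPGroup : ∀ (G : Type u) [Group G] [Finite G] (P N : Subgroup G) [N.Normal],
      IsSelfNormalizingSylow p P → IsPGroup p N → N ≤ P →
      motive (G ⧸ N) (P.map (QuotientGroup.mk' N)) →
      (∀ T : Subgroup G, P ≤ T → T ≠ ⊤ → motive T (P.subgroupOf T)) → motive G P)
    {G : Type u} [Group G] [Finite G] (hG : IsPSolvable p G) {P : Subgroup G}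
    (hP : IsSelfNormalizingSylow p P) : motive G P := by
  induction hn : Nat.card G using Nat.strong_induction_on generalizing G with
  | h n ih =>
  subst hn
  rcases subsingleton_or_nontrivial G with hsub | hnt
  · exact subsingleton G P
  obtain ⟨N, _, hN1, hN⟩ := hG.exists_normal
  have hmk := QuotientGroup.mk'_surjective N
  have hquot := ih _ (card_quotient_lt hN1) (hG.map _ hmk) (hP.map hmk) rfl
  rcases hN with hN | hN
  · refine isPGroup G P N hP hN (hN.le_sylow_of_normal (hP.isPGroup.toSylow hP.not_dvd_index))
      hquot fun T hPT hT => ih _ ?_ (hG.subgroup T) (hP.subgroupOf hPT) rfl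
    exact T.card_le_card_group.lt_of_ne (T.card_eq_iff_eq_top.not.2 hT)
  · exact coprime G P N hP hN hquot

theorem exists_weightSpace_ne_bot_of_isPGroup {P : Type*} [Group P] [Finite P] (hP : IsPGroup p P)
    {V : Type v} [AddCommGroup V] [Module ℂ V] [FiniteDimensional ℂ V]
    (ρ : Representation ℂ P V) (hV : ¬ p ∣ Module.finrank ℂ V) :
    ∃ ν, weightSpace ρ ν ≠ ⊥ := by
  obtain ⟨n, σ, f, hσ, hf, hn⟩ := exists_isIrreducible_injective_of_not_dvd_finrank ρ hV
  have hσ1 := finrank_eq_one_of_isPGroup hP hσ (by rwa [Module.finrank_fin_fun])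
  obtain ⟨ν, hν⟩ := exists_weightSpace_eq_top_of_finrank_eq_one σ hσ1
  have := Module.nontrivial_of_finrank_eq_succ hσ1
  obtain ⟨v, hv⟩ := exists_ne (0 : Fin n → ℂ)
  refine ⟨ν, (Submodule.ne_bot_iff _).2 ⟨f v, fun g => ?_, (map_ne_zero_iff f hf).2 hv⟩⟩
  rw [← f.isIntertwining, Submodule.eq_top_iff'.1 hν v g, map_smul]

theorem hasUniqueLinearConstituent {G : Type u} [Group G] [Finite G] (hG : IsPSolvable p G)
    {P : Subgroup G} (hP : IsSelfNormalizingSylow p P) {V : Type v} [AddCommGroup V]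
    [Module ℂ V] [FiniteDimensional ℂ V] {ρ : Representation ℂ G V} (hρ : ρ.IsIrreducible)
    (hV : ¬ p ∣ Module.finrank ℂ V) : HasUniqueLinearConstituent P ρ := by
  revert V
  refine IsPSolvable.induction (motive := fun G _ P => ∀ {V : Type v} [AddCommGroup V]
    [Module ℂ V] [FiniteDimensional ℂ V] {ρ : Representation ℂ G V} (_ : ρ.IsIrreducible)
    (_ : ¬ p ∣ Module.finrank ℂ V), HasUniqueLinearConstituent P ρ) ?_ ?_ ?_ hG hP
  · intro G _ _ P V _ _ _ ρ hρ _
    exact .of_subsingleton hρ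
  · intro G _ _ P N _ hP hN quotient V _ _ _ ρ hρ hV
    obtain ⟨σ, hσ, rfl⟩ :=
      exists_isIrreducible_comp_mk' hρ (weightSpace_one_eq_top_of_coprime hP hN hρ hV)
    exact (quotient hσ hV).comp (QuotientGroup.mk'_surjective N) hP
  · intro G _ _ P N _ hP hN hNP quotient subgroup V _ _ _ ρ hρ hV
    obtain ⟨ν, hν⟩ := exists_weightSpace_ne_bot_of_isPGroup hP.isPGroup (resRep ρ P) hV
    have hμ := ne_bot_of_le_ne_bot hν (weightSpace_resRep_le hNP ν)
    have hPμ : P ≤ MulAction.stabilizer G (ν.comp (Subgroup.inclusion hNP)) :=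
      fun x => smul_comp_inclusion hNP ν
    by_cases hT : MulAction.stabilizer G (ν.comp (Subgroup.inclusion hNP)) = ⊤
    · have htop := weightSpace_eq_top_of_stabilizer_eq_top hρ hμ hT
      obtain ⟨κ, hκ⟩ := exists_extension_of_weightSpace_eq_top hN hV htop
      obtain ⟨σ, hσ, rfl⟩ := exists_isIrreducible_twist_comp_mk' hρ (hκ ▸ htop)
      exact ((quotient hσ hV).comp (QuotientGroup.mk'_surjective N) hP).twist κ
    · exact .of_stabRep hP hNP hρ hμ hPμ <| subgroup _ hPμ hT (isIrreducible_stabRep hρ hμ)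
        (not_dvd_finrank_weightSpace hρ hμ hV)

theorem character_eq_of_weightSpace_ne_bot {G : Type u} [Group G] [Finite G]
    (hG : IsPSolvable p G) {P : Subgroup G} (hP : IsSelfNormalizingSylow p P) {V V' : Type v}
    [AddCommGroup V] [Module ℂ V] [FiniteDimensional ℂ V]
    [AddCommGroup V'] [Module ℂ V'] [FiniteDimensional ℂ V']
    {ρ : Representation ℂ G V} {ρ' : Representation ℂ G V'}
    (hρ : ρ.IsIrreducible) (hρ' : ρ'.IsIrreducible)
    (hV : ¬ p ∣ Module.finrank ℂ V) (hV' : ¬ p ∣ Module.finrank ℂ V') {ν : P →* ℂˣ}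
    (hν : weightSpace (resRep ρ P) ν ≠ ⊥) (hν' : weightSpace (resRep ρ' P) ν ≠ ⊥) :
    ρ.character = ρ'.character := by
  revert V V'
  refine IsPSolvable.induction (motive := fun G _ P => ∀ {ν : P →* ℂˣ} {V V' : Type v}
    [AddCommGroup V] [Module ℂ V] [FiniteDimensional ℂ V]
    [AddCommGroup V'] [Module ℂ V'] [FiniteDimensional ℂ V']
    {ρ : Representation ℂ G V} {ρ' : Representation ℂ G V'}
    (_ : ρ.IsIrreducible) (_ : ρ'.IsIrreducible)
    (_ : ¬ p ∣ Module.finrank ℂ V) (_ : ¬ p ∣ Module.finrank ℂ V')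
    (_ : weightSpace (resRep ρ P) ν ≠ ⊥) (_ : weightSpace (resRep ρ' P) ν ≠ ⊥),
    ρ.character = ρ'.character) ?_ ?_ ?_ hG hP
  · intro G _ _ P ν V V' _ _ _ _ _ _ ρ ρ' hρ hρ' _ _ _ _
    ext g
    rw [Subsingleton.elim g 1, char_one, char_one,
      IsIrreducible.finrank_eq_one_of_isMulCommutative ρ,
      IsIrreducible.finrank_eq_one_of_isMulCommutative ρ']
  · intro G _ _ P N _ hP hN quotient ν V V' _ _ _ _ _ _ ρ ρ' hρ hρ' hV hV' hν hν'
    obtain ⟨σ, hσ, rfl⟩ :=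
      exists_isIrreducible_comp_mk' hρ (weightSpace_one_eq_top_of_coprime hP hN hρ hV)
    obtain ⟨σ', hσ', rfl⟩ :=
      exists_isIrreducible_comp_mk' hρ' (weightSpace_one_eq_top_of_coprime hP hN hρ' hV')
    exact character_comp_eq_of_weightSpace_ne_bot (fun _ => quotient hσ hσ' hV hV') hν hν'
  · intro G _ _ P N _ hP hN hNP quotient subgroup ν V V' _ _ _ _ _ _ ρ ρ' hρ hρ' hV hV' hν hν'
    have hμ := ne_bot_of_le_ne_bot hν (weightSpace_resRep_le hNP ν)
    have hμ' := ne_bot_of_le_ne_bot hν' (weightSpace_resRep_le hNP ν)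
    have hPμ : P ≤ MulAction.stabilizer G (ν.comp (Subgroup.inclusion hNP)) :=
      fun x => smul_comp_inclusion hNP ν
    by_cases hT : MulAction.stabilizer G (ν.comp (Subgroup.inclusion hNP)) = ⊤
    · have htop := weightSpace_eq_top_of_stabilizer_eq_top hρ hμ hT
      have htop' := weightSpace_eq_top_of_stabilizer_eq_top hρ' hμ' hT
      obtain ⟨κ, hκ⟩ := exists_extension_of_weightSpace_eq_top hN hV htop
      obtain ⟨σ, hσ, rfl⟩ := exists_isIrreducible_twist_comp_mk' hρ (hκ ▸ htop)
      obtain ⟨σ', hσ', rfl⟩ := exists_isIrreducible_twist_comp_mk' hρ' (hκ ▸ htop')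
      rw [weightSpace_resRep_twist] at hν hν'
      ext g
      rw [character_twist, character_twist, character_comp_eq_of_weightSpace_ne_bot
        (fun _ => quotient hσ hσ' hV hV') hν hν']
    · refine character_eq_of_character_stabRep_eq hρ hρ' hμ hμ' <| subgroup _ hPμ hT
        (isIrreducible_stabRep hρ hμ) (isIrreducible_stabRep hρ' hμ')
        (not_dvd_finrank_weightSpace hρ hμ hV) (not_dvd_finrank_weightSpace hρ' hμ' hV')
        ((weightSpace_stabRep_ne_bot_iff hP hNP hρ hμ hPμ ν).2 hν)
        ((weightSpace_stabRep_ne_bot_iff hP hNP hρ' hμ' hPμ ν).2 hν')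

end PSolvable

section Coinduction

variable {k G V : Type*} [Field k] [Group G] [AddCommGroup V] [Module k V] {P : Subgroup G}

theorem finrank_coindV [FiniteDimensional k V] [P.FiniteIndex] (σ : Representation k P V) :
    Module.finrank k (coindV P.subtype σ) = P.index * Module.finrank k V := by
  obtain ⟨T, hT, -⟩ := P.exists_isComplement_right 1
  let e : coindV P.subtype σ ≃ₗ[k] (T → V) :=
    { toFun := fun f t => f.1 t
      map_add' := fun _ _ => rfl
      map_smul' := fun _ _ => rfl
      invFun := fun a => ⟨fun g => σ (hT.equiv g).1 (a (hT.equiv g).2), fun x g => by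
        change σ (hT.equiv (x * g)).1 (a (hT.equiv (x * g)).2) = _
        rw [hT.equiv_mul_left, map_mul, Module.End.mul_apply]⟩
      left_inv := fun f => Subtype.ext <| funext fun g => by
        change σ (hT.equiv g).1 (f.1 (hT.equiv g).2) = f.1 g
        rw [← f.2]
        exact congrArg f.1 (hT.equiv_fst_mul_equiv_snd g)
      right_inv := fun a => funext fun t => by
        change σ (hT.equiv t).1 (a (hT.equiv t).2) = a t
        rw [hT.equiv_fst_eq_one_of_mem_of_one_mem P.one_mem t.2,
          hT.equiv_snd_eq_self_of_mem_of_one_mem P.one_mem t.2]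
        exact LinearMap.congr_fun (map_one σ) (a t) }
  have : Finite T := hT.finite_right
  have := Fintype.ofFinite T
  rw [e.finrank_eq, Module.finrank_pi_fintype, Finset.sum_const, Finset.card_univ, smul_eq_mul,
    ← Nat.card_eq_fintype_card, hT.card_right]

theorem weightSpace_ne_bot_of_apply_eq_mul [Finite G] [CharZero k] {ρ : Representation k G V}
    {ν : G →* kˣ} (ℓ : V →ₗ[k] k) (hℓ : ∀ g v, ℓ (ρ g v) = ν g * ℓ v) {v : V} (hv : ℓ v ≠ 0) :
    weightSpace ρ ν ≠ ⊥ := by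
  have := Fintype.ofFinite G
  have hproj : ℓ (weightProj ρ ν v) = ℓ v := by
    simp [weightProj_apply, hℓ]
  refine (Submodule.ne_bot_iff _).2 ⟨_, weightProj_mem ρ ν v, fun h => hv ?_⟩
  rw [← hproj, h, map_zero]

theorem weightSpace_ne_bot_of_coind [Finite P] [CharZero k] {ρ : Representation k G V}
    {ν : P →* kˣ} (f : ρ.IntertwiningMap (coind P.subtype (twist (trivial k P k) ν))) {v : V}
    (hv : f v ≠ 0) : weightSpace (resRep ρ P) ν ≠ ⊥ := by
  obtain ⟨g, hg⟩ : ∃ g, (f v).1 g ≠ 0 := by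
    by_contra! h
    exact hv (Subtype.ext (funext h))
  have hf (g : G) (v : V) : (f (ρ g v)).1 1 = (f v).1 g := by
    rw [f.isIntertwining]
    exact congrArg (f v).1 (one_mul g)
  refine weightSpace_ne_bot_of_apply_eq_mul
    (LinearMap.proj 1 ∘ₗ (coindV P.subtype _).subtype ∘ₗ f.toLinearMap) (fun x w => ?_)
    (v := ρ g v) ((hf g v).trans_ne hg)
  refine (hf x w).trans ?_
  rw [← mul_one (x : G)]
  exact (f w).2 x 1

theorem exists_isIrreducible_weightSpace_ne_bot {p : ℕ} {G : Type*} [Group G] [Finite G]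
    {P : Subgroup G} (hP : ¬ p ∣ P.index) (ν : P →* ℂˣ) :
    ∃ (n : ℕ) (ρ : Representation ℂ G (Fin n → ℂ)), ρ.IsIrreducible ∧ ¬ p ∣ n ∧
      weightSpace (resRep ρ P) ν ≠ ⊥ := by
  obtain ⟨n, ρ, f, hρ, hf, hn⟩ := exists_isIrreducible_injective_of_not_dvd_finrank (p := p)
    (coind P.subtype (twist (trivial ℂ P ℂ) ν))
    (by rwa [finrank_coindV, Module.finrank_self, mul_one])
  have := ((isIrreducible_iff ρ).1 hρ).1
  obtain ⟨v, hv⟩ := exists_ne (0 : Fin n → ℂ)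
  exact ⟨n, ρ, hρ, hn, weightSpace_ne_bot_of_coind f ((map_ne_zero_iff f hf).2 hv)⟩

end Coinduction

section CharacterSets

variable {G V : Type*} [Group G] [AddCommGroup V] [Module ℂ V]

theorem character_eq_add_of_isCompl [FiniteDimensional ℂ V] {ρ : Representation ℂ G V}
    {U U' : Subrepresentation ρ} (h : IsCompl U.toSubmodule U'.toSubmodule) :
    ρ.character = U.toRepresentation.character + U'.toRepresentation.character := by
  ext g
  let N : Bool → Submodule ℂ V := fun b => cond b U.toSubmodule U'.toSubmodule
  have hN : DirectSum.IsInternal N :=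
    (DirectSum.isInternal_submodule_iff_isCompl N (i := true) (j := false) (by simp)
      (by ext b; cases b <;> simp)).2 h
  have hg : ∀ b, Set.MapsTo (ρ g) (N b) (N b) :=
    Bool.forall_bool.2
      ⟨fun _ hv => U'.apply_mem_toSubmodule g hv, fun _ hv => U.apply_mem_toSubmodule g hv⟩
  have htrace := LinearMap.trace_eq_sum_trace_restrict hN hg
  rwa [Fintype.sum_bool] at htrace

theorem exists_character_eq_of_finrank_eq_one (ρ : Representation ℂ G V)
    (h : Module.finrank ℂ V = 1) : ∃ ν : G →* ℂˣ, ρ.character = fun g => (ν g : ℂ) := by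
  have := Module.finite_of_finrank_eq_succ h
  obtain ⟨ν, hν⟩ := exists_weightSpace_eq_top_of_finrank_eq_one ρ h
  refine ⟨ν, funext fun g => ?_⟩
  rw [character_eq_of_weightSpace_eq_top hν, h, Nat.cast_one, mul_one]

theorem coe_linearCharacter_injective :
    Function.Injective fun (ν : G →* ℂˣ) (g : G) => (ν g : ℂ) := fun ν ν' h => by
  ext g
  exact congrFun h g

theorem image_irr_abelianization (G : Type*) [Group G] :
    (fun (ψ : Abelianization G → ℂ) (g : G) => ψ (Abelianization.of g)) ''
      Irr (Abelianization G) = Set.range fun (ν : G →* ℂˣ) (g : G) => (ν g : ℂ) := by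
  ext f
  constructor
  · rintro ⟨_, ⟨n, ρ, hρ, rfl⟩, rfl⟩
    obtain ⟨ν, hν⟩ := exists_character_eq_of_finrank_eq_one ρ
      (IsIrreducible.finrank_eq_one_of_isMulCommutative ρ)
    exact ⟨ν.comp Abelianization.of, funext fun g => (congrFun hν _).symm⟩
  · rintro ⟨ν, rfl⟩
    exact ⟨_, linear_mem_irr (Abelianization.lift ν), funext fun g => by simp⟩

theorem mem_irrPrime_iff {p : ℕ} {χ : G → ℂ} :
    χ ∈ IrrPrime p G ↔ ∃ (n : ℕ) (ρ : Representation ℂ G (Fin n → ℂ)), ρ.IsIrreducible ∧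
      ¬ p ∣ Module.finrank ℂ (Fin n → ℂ) ∧ χ = ρ.character := by
  constructor
  · rintro ⟨⟨n, ρ, hρ, rfl⟩, d, hd, hp⟩
    rw [char_one, Nat.cast_inj] at hd
    exact ⟨n, ρ, hρ, hd ▸ hp, rfl⟩
  · rintro ⟨n, ρ, hρ, hp, rfl⟩
    exact ⟨⟨n, ρ, hρ, rfl⟩, _, char_one ρ, hp⟩

theorem disjoint_irrPrime_neg (p : ℕ) (G : Type*) [Group G] :
    Disjoint (IrrPrime p G) (-IrrPrime p G) := by
  rw [Set.disjoint_left]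
  rintro χ ⟨-, d, hd, hp⟩ ⟨-, d', hd', -⟩
  rw [Pi.neg_apply, hd, neg_eq_iff_add_eq_zero] at hd'
  have h0 : d + d' = 0 := by exact_mod_cast hd'
  exact hp ((Nat.add_eq_zero_iff.1 h0).1 ▸ dvd_zero p)

variable [Finite G]

theorem character_mem_genChar [FiniteDimensional ℂ V] (ρ : Representation ℂ G V) :
    ρ.character ∈ genChar G := by
  induction hn : Module.finrank ℂ V using Nat.strong_induction_on generalizing V with
  | h n ih =>
  subst hn
  by_cases hρ : ρ.IsIrreducible
  · exact AddSubgroup.subset_closure (character_mem_irr hρ)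
  rcases subsingleton_or_nontrivial V with hV | hV
  · convert zero_mem (genChar G)
    ext g
    exact (congrArg _ (Subsingleton.elim (ρ g) 0)).trans (map_zero _)
  · obtain ⟨U, U', hc, hU, hU'⟩ := exists_isCompl_finrank_lt hρ
    rw [character_eq_add_of_isCompl hc]
    exact add_mem (ih _ hU _ rfl) (ih _ hU' _ rfl)

theorem IsCharacterOrZero.mem_genChar {f : G → ℂ} (hf : IsCharacterOrZero f) : f ∈ genChar G := by
  obtain ⟨n, ρ, rfl⟩ := hf
  exact character_mem_genChar ρ

theorem irrPrime_eq_range_of_isPGroup {p : ℕ} [Fact p.Prime] (hG : IsPGroup p G) :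
    IrrPrime p G = Set.range fun (ν : G →* ℂˣ) (g : G) => (ν g : ℂ) := by
  ext χ
  constructor
  · rw [mem_irrPrime_iff]
    rintro ⟨n, ρ, hρ, hp, rfl⟩
    obtain ⟨ν, hν⟩ :=
      exists_character_eq_of_finrank_eq_one ρ (finrank_eq_one_of_isPGroup hG hρ hp)
    exact ⟨ν, hν.symm⟩
  · rintro ⟨ν, rfl⟩
    exact ⟨linear_mem_irr ν, 1, by simp, (Fact.out : p.Prime).not_dvd_one⟩

variable [FiniteDimensional ℂ V]

theorem isCharacterOrZero_sub_of_weightSpace_ne_bot {ρ : Representation ℂ G V} {ν : G →* ℂˣ}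
    (h : weightSpace ρ ν ≠ ⊥) : IsCharacterOrZero fun g => ρ.character g - ν g := by
  obtain ⟨v, hv, hv0⟩ := Submodule.exists_mem_ne_zero_of_ne_bot h
  let U : Subrepresentation ρ := ⟨ℂ ∙ v, fun g w hw => by
    have hle : ℂ ∙ v ≤ weightSpace ρ ν := (Submodule.span_singleton_le_iff_mem v _).2 hv
    rw [hle hw g]
    exact Submodule.smul_mem _ _ hw⟩
  obtain ⟨U', hc⟩ := exists_isCompl_subrepresentation U
  have hU : weightSpace U.toRepresentation ν = ⊤ := Submodule.eq_top_iff'.2 fun w g => by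
    have hle : ℂ ∙ v ≤ weightSpace ρ ν := (Submodule.span_singleton_le_iff_mem v _).2 hv
    exact Subtype.ext (hle w.2 g)
  have hrank : Module.finrank ℂ U.toSubmodule = 1 := finrank_span_singleton hv0
  convert isCharacterOrZero_character U'.toRepresentation using 1
  ext g
  rw [character_eq_add_of_isCompl hc, Pi.add_apply, character_eq_of_weightSpace_eq_top hU, hrank,
    Nat.cast_one, mul_one, add_sub_cancel_left]

theorem finrank_weightSpace_eq_of_character_eq {V' : Type*} [AddCommGroup V'] [Module ℂ V']
    [FiniteDimensional ℂ V'] {ρ : Representation ℂ G V} {ρ' : Representation ℂ G V'}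
    (h : ρ.character = ρ'.character) (ν : G →* ℂˣ) :
    Module.finrank ℂ (weightSpace ρ ν) = Module.finrank ℂ (weightSpace ρ' ν) := by
  have := Fintype.ofFinite G
  have htrace : LinearMap.trace ℂ V (weightProj ρ ν) = LinearMap.trace ℂ V' (weightProj ρ' ν) := by
    simp only [weightProj, finsum_eq_sum_of_fintype, map_smul, map_sum]
    exact congrArg _ (Finset.sum_congr rfl fun g _ => congrArg _ (congrFun h g))
  rwa [(isProj_weightProj ρ ν).trace, (isProj_weightProj ρ' ν).trace, Nat.cast_inj] at htrace

theorem weightSpace_ne_bot_iff_of_character_eq {V' : Type*} [AddCommGroup V'] [Module ℂ V']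
    [FiniteDimensional ℂ V'] {ρ : Representation ℂ G V} {ρ' : Representation ℂ G V'}
    (h : ρ.character = ρ'.character) (ν : G →* ℂˣ) :
    weightSpace ρ ν ≠ ⊥ ↔ weightSpace ρ' ν ≠ ⊥ := by
  rw [← Submodule.one_le_finrank_iff, ← Submodule.one_le_finrank_iff,
    finrank_weightSpace_eq_of_character_eq h]

end CharacterSets

section SignedExtension

variable {M N : Type*} [InvolutiveNeg M] [InvolutiveNeg N]

theorem exists_bijOn_union_neg {f : M → N} {A : Set M} {B : Set N} (hf : Set.BijOn f A B)
    (hA : Disjoint A (-A)) (hB : Disjoint B (-B)) :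
    ∃ F : M → N, Set.EqOn F f A ∧ (∀ a ∈ A ∪ -A, F (-a) = -F a) ∧
      Set.BijOn F (A ∪ -A) (B ∪ -B) := by
  classical
  let F : M → N := fun a => if a ∈ A then f a else -f (-a)
  have hpos : Set.EqOn F f A := fun a ha => if_pos ha
  have hneg (a : M) (ha : a ∈ A) : F (-a) = -F a := by
    have ha' : -a ∉ A := fun h => Set.disjoint_left.1 hA ha h
    simp only [F, if_pos ha, if_neg ha', neg_neg]
  have hbij : Set.BijOn F A B := hf.congr hpos.symm
  have hbij_neg : Set.BijOn F (-A) (-B) := by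
    have hconj : Set.BijOn (fun b => -F (-b)) (-A) (-B) :=
      ((Equiv.neg N).bijOn fun b => by simp).comp
        (hbij.comp ((Equiv.neg M).bijOn fun a => by simp))
    exact hconj.congr fun a ha => (hneg (-a) ha).symm.trans (congrArg F (neg_neg a))
  refine ⟨F, hpos, ?_, hbij.union hbij_neg ?_⟩
  · rintro a (ha | ha)
    · exact hneg a ha
    · rw [← neg_neg a, hneg _ ha, neg_neg, neg_neg]
  · exact (Set.injOn_union hA).2 ⟨hbij.injOn, hbij_neg.injOn, fun a ha a' ha' =>
      hB.ne_of_mem (hbij.mapsTo ha) (hbij_neg.mapsTo ha')⟩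

end SignedExtension

section Correspondence

variable {p : ℕ} [Fact p.Prime] {G : Type*} [Group G] [Finite G] {P : Subgroup G}

theorem exists_linearConstituent (hG : IsPSolvable p G) (hP : IsSelfNormalizingSylow p P)
    {χ : G → ℂ} (hχ : χ ∈ IrrPrime p G) :
    ∃ lam : P →* ℂˣ,
      (∀ (n : ℕ) (ρ : Representation ℂ G (Fin n → ℂ)), χ = ρ.character →
        ∀ ν, weightSpace (resRep ρ P) ν ≠ ⊥ ↔ ν = lam) ∧
      ∃ Δ, IsCharacterOrZero Δ ∧ Δ ∈ sumsIndNonPicky P ∧ res P χ = (fun x => (lam x : ℂ)) + Δ := by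
  obtain ⟨n, ρ, hρ, hn, rfl⟩ := mem_irrPrime_iff.1 hχ
  obtain ⟨lam, hlam, Δ, hΔ, hsum⟩ := hasUniqueLinearConstituent hG hP hρ hn
  refine ⟨lam, fun m σ h ν => ?_, Δ, ?_, hΔ, funext hsum⟩
  · rw [← hlam]
    exact weightSpace_ne_bot_iff_of_character_eq (ρ := resRep σ P) (ρ' := resRep ρ P)
      (funext fun x => (congrFun h x).symm) ν
  · convert isCharacterOrZero_sub_of_weightSpace_ne_bot ((hlam lam).2 rfl) using 2 with x
    exact eq_sub_of_add_eq' (hsum x).symm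

theorem exists_bijOn_irrPrime (hG : IsPSolvable p G) (hP : IsSelfNormalizingSylow p P) :
    ∃ lam : (G → ℂ) → (P → ℂ),
      (∀ χ ∈ IrrPrime p G, ∃ Δ, IsCharacterOrZero Δ ∧ Δ ∈ sumsIndNonPicky P ∧
        res P χ = lam χ + Δ) ∧
      Set.BijOn lam (IrrPrime p G) (Set.range fun (ν : P →* ℂˣ) (x : P) => (ν x : ℂ)) := by
  choose! lam hlam hΔ using fun χ (hχ : χ ∈ IrrPrime p G) => exists_linearConstituent hG hP hχ
  refine ⟨fun χ x => lam χ x, hΔ, fun χ _ => ⟨lam χ, rfl⟩, fun χ hχ χ' hχ' heq => ?_, ?_⟩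
  · obtain ⟨n, ρ, hρ, hn, h⟩ := mem_irrPrime_iff.1 hχ
    obtain ⟨n', ρ', hρ', hn', h'⟩ := mem_irrPrime_iff.1 hχ'
    rw [h, h']
    exact character_eq_of_weightSpace_ne_bot hG hP hρ hρ' hn hn' ((hlam χ hχ n ρ h _).2 rfl)
      ((hlam χ' hχ' n' ρ' h' _).2 (coe_linearCharacter_injective heq))
  · rintro _ ⟨ν, rfl⟩
    obtain ⟨n, ρ, hρ, hn, hν⟩ := exists_isIrreducible_weightSpace_ne_bot hP.not_dvd_index ν
    have hχ : ρ.character ∈ IrrPrime p G :=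
      mem_irrPrime_iff.2 ⟨n, ρ, hρ, by rwa [Module.finrank_fin_fun], rfl⟩
    exact ⟨_, hχ, by rw [(hlam _ hχ n ρ rfl ν).1 hν]⟩

theorem mem_evI_of_mem_sumsIndNonPicky (hP : IsPGroup p P) {Δ : P → ℂ}
    (hΔ : Δ ∈ sumsIndNonPicky P) :
    Δ ∈ evI p (P.subgroupOf P) {Q : Subgroup P | Q.map P.subtype ∈ evS P P} := by
  suffices hle : sumsIndNonPicky P ≤
      (evI p (P.subgroupOf P) {Q : Subgroup P | Q.map P.subtype ∈ evS P P}).toAddSubmonoid from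
    hle hΔ
  refine AddSubmonoid.closure_le.2 ?_
  rintro _ ⟨Q, θ, hQ, hθ, rfl⟩
  refine AddSubgroup.subset_closure ⟨Q, θ, hθ.mem_genChar, ?_, ?_, rfl⟩
  · rw [Subgroup.subgroupOf_self, Subgroup.top_subgroupOf]
    have htop : IsPGroup p (⊤ : Subgroup Q) := (hP.to_subgroup Q).to_subgroup ⊤
    exact ⟨htop.toSylow (by simpa using (Fact.out : p.Prime).ne_one), rfl⟩
  · obtain ⟨g, hg, hne⟩ : ∃ g, Q.map P.subtype ≤ conjBy P g ∧ conjBy P g ≠ P := by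
      simpa only [IsPicky, not_forall, exists_prop] using hQ
    rw [Subgroup.subgroupOf_self, inf_top_eq]
    exact ⟨Subgroup.map_subtype_le Q, g, fun h => hne (conjBy_of_mem h), hg⟩

theorem ircSyl_of_bijOn {P : Sylow p G} (hP : IsSelfNormalizingSylow p (P : Subgroup G))
    {lam : (G → ℂ) → (↥(P : Subgroup G) → ℂ)}
    (hlam : ∀ χ ∈ IrrPrime p G, ∃ Δ ∈ sumsIndNonPicky (P : Subgroup G),
      res (P : Subgroup G) χ = lam χ + Δ)
    (hbij : Set.BijOn lam (IrrPrime p G) (IrrPrime p (P : Subgroup G))) : IRCSyl p P := by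
  obtain ⟨F, hFlam, hFneg, hFbij⟩ := exists_bijOn_union_neg hbij (disjoint_irrPrime_neg p G)
    (disjoint_irrPrime_neg p (P : Subgroup G))
  have hdiff (χ : G → ℂ) (hχ : χ ∈ IrrPrime p G) :
      F χ - res (P : Subgroup G) χ ∈ evI p ((P : Subgroup G).subgroupOf P)
        {Q | Q.map (P : Subgroup G).subtype ∈ evS (P : Subgroup G) P} := by
    obtain ⟨Δ, hΔ, hres⟩ := hlam χ hχ
    rw [hFlam hχ, hres, sub_add_cancel_left]
    exact neg_mem (mem_evI_of_mem_sumsIndNonPicky hP.isPGroup hΔ)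
  have hN : Subgroup.normalizer (P : Set G) = (P : Subgroup G) := hP.normalizer_eq
  rw [IRCSyl, hN]
  refine ⟨F, hFbij, fun χ hχ => ⟨hFneg χ hχ, ?_⟩⟩
  rcases hχ with hχ | hχ
  · exact hdiff χ hχ
  · have hneg : F χ - res (P : Subgroup G) χ = -(F (-χ) - res (P : Subgroup G) (-χ)) := by
      rw [hFneg χ (Or.inr hχ)]
      ext x
      simp only [res, Pi.sub_apply, Pi.neg_apply]
      ring
    rw [hneg]
    exact neg_mem (hdiff _ hχ)

end Correspondence

end EvseevPicky

theorem theorem5p3 {G : Type*} [Group G] [Finite G] (p : ℕ) [Fact p.Prime]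
    (hG : EvseevPicky.IsPSolvable p G) (P : Sylow p G)
    (hP : Subgroup.normalizer (P : Set G) = (P : Subgroup G)) :
    (∃ lam : (G → ℂ) → (↥(P : Subgroup G) → ℂ),
      (∀ χ ∈ EvseevPicky.IrrPrime p G,
        lam χ ∈ EvseevPicky.Irr ↥(P : Subgroup G) ∧ lam χ 1 = 1 ∧
        ∃ Δ : ↥(P : Subgroup G) → ℂ,
          EvseevPicky.IsCharacterOrZero Δ ∧
          Δ ∈ EvseevPicky.sumsIndNonPicky (P : Subgroup G) ∧
          EvseevPicky.res (P : Subgroup G) χ = lam χ + Δ) ∧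
      -- the irreducible characters of `P / P'`, inflated to `P`
      Set.BijOn lam (EvseevPicky.IrrPrime p G)
        ((fun (ψ : Abelianization ↥(P : Subgroup G) → ℂ) (x : ↥(P : Subgroup G)) =>
            ψ (Abelianization.of x)) ''
          EvseevPicky.Irr (Abelianization ↥(P : Subgroup G)))) ∧
    EvseevPicky.IRCSyl p P := by
  have hP' : EvseevPicky.IsSelfNormalizingSylow p (P : Subgroup G) := ⟨P.2, P.not_dvd_index, hP⟩
  obtain ⟨lam, hlam, hbij⟩ := EvseevPicky.exists_bijOn_irrPrime hG hP'
  refine ⟨⟨lam, fun χ hχ => ?_, by rwa [EvseevPicky.image_irr_abelianization]⟩,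
    EvseevPicky.ircSyl_of_bijOn hP' (fun χ hχ => ?_)
      (by rwa [EvseevPicky.irrPrime_eq_range_of_isPGroup P.2])⟩
  · obtain ⟨ν, hν⟩ := hbij.mapsTo hχ
    rw [← hν]
    exact ⟨EvseevPicky.linear_mem_irr ν, by simp, hν ▸ hlam χ hχ⟩
  · obtain ⟨Δ, -, hΔ, hres⟩ := hlam χ hχ
    exact ⟨Δ, hΔ, hres⟩
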